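/- Let $K$ be an algebraically closed field, let $\mathcal Q$ be a finite quiver (paths are written from left to right), and let $\Lambda=K\mathcal Q/I$ be a finite-dimensional algebra, where the two-sided ideal $I$ is generated by a set $g^2$ of uniform elements of $K\mathcal Q$ ($x$ is uniform if $x=vx=xv'$ for some vertices $v,v'$). Let $A\geq 1$. The stretched quiver $\tilde{\mathcal Q}$ has as vertices those of $\mathcal Q$ together with, for each arrow $\alpha$ of $\mathcal Q$, new vertices $w_1,\dots,w_{A-1}$; its arrows are, for each arrow $\alpha: v\to v'$ of $\mathcal Q$, the $A$ arrows $\alpha_1,\dots,\alpha_A$ forming a path $v\to w_1\to\cdots\to w_{A-1}\to v'$. Let $\theta^*:K\mathcal Q\to K\tilde{\mathcal Q}$ be the $K$-linear map that is multiplicative, fixes the vertices of $\mathcal Q$ and sends each arrow $\alpha$ to $\alpha_1\alpha_2\cdots\alpha_A$. The stretched algebra is $\tilde\Lambda=K\tilde{\mathcal Q}/\tilde I$, where $\tilde I$ is the two-sided ideal generated by $\theta^*(g^2)$, and $\varepsilon\in\tilde\Lambda$ is the idempotent given by the sum of the vertices of $\mathcal Q$. For a finite-dimensional algebra $R$, let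 $\operatorname{mod}R$ be the category of finite-dimensional right $R$-modules. Then $\tilde\Lambda$ is finite-dimensional and the following hold. 1. $\langle\varepsilon\rangle=\tilde\Lambda\varepsilon\tilde\Lambda$ is a stratifying ideal of $\tilde\Lambda$: the multiplication map $\tilde\Lambda\varepsilon\otimes_{\varepsilon\tilde\Lambda\varepsilon}\varepsilon\tilde\Lambda\to\tilde\Lambda\varepsilon\tilde\Lambda$ is an isomorphism and $\operatorname{Tor}_n^{\varepsilon\tilde\Lambda\varepsilon}(\tilde\Lambda\varepsilon,\varepsilon\tilde\Lambda)=0$ for all $n>0$. 2. The functor $\operatorname{res}_\varepsilon=(-)\varepsilon:\operatorname{mod}\tilde\Lambda\to\operatorname{mod}\varepsilon\tilde\Lambda\varepsilon$ is a $2$-homological isomorphism, that is, for all $X,Y$ in $\operatorname{mod}\tilde\Lambda$ and all $j>2$ there is a group isomorphism $\operatorname{Ext}^j_{\tilde\Lambda}(X,Y)\cong\operatorname{Ext}^j_{\varepsilon\tilde\Lambda\varepsilon}(X\varepsilon,Y\varepsilon)$ (not required to be induced by the functor). Hence it is an eventually homological isomorphism, that is, a $t$-homological isomorphism for some integer $t$.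 3. The injective dimensions of the algebras as right modules over themselves satisfy $\operatorname{id}_{\tilde\Lambda}\tilde\Lambda\leq\sup\{\operatorname{id}_\Lambda\Lambda,2\}$ (as elements of $\{-\infty\}\cup\mathbb N\cup\{\infty\}$, the zero module having dimension $-\infty$). -/

import Mathlib

open CategoryTheory MulOpposite
open scoped TensorProduct

universe u v w

noncomputable section

/-! ### The path algebra of a finite quiver

`PathAlgebra K V` is the `K`-vector space with basis the paths of the quiver `V`, sorted by their
starting and ending vertices (there are finitely many vertices, so this is the direct sum over all
pairs of vertices).  Paths are read from left to right and multiplied by concatenation. -/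

/-- The path algebra `KQ` of the quiver `V`. -/
def PathAlgebra (K : Type u) (V : Type v) [Field K] [Quiver.{w} V] : Type (max u v w) :=
  ∀ a b : V, Quiver.Path a b →₀ K

namespace PathAlgebra

section Basic

variable (K : Type u) {V : Type v} [Field K] [Quiver.{w} V]

instance : AddCommGroup (PathAlgebra K V) :=
  inferInstanceAs (AddCommGroup (∀ a b : V, Quiver.Path a b →₀ K))

instance : Module K (PathAlgebra K V) :=
  inferInstanceAs (Module K (∀ a b : V, Quiver.Path a b →₀ K))

@[ext] theorem ext {K : Type u} [Field K] {f g : PathAlgebra K V} (h : ∀ a b, f a b = g a b) :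
    f = g :=
  funext fun a => funext fun b => h a b

/-- Concatenation of paths, extended bilinearly. -/
def concat (a b c : V) :
    (Quiver.Path a b →₀ K) →ₗ[K] (Quiver.Path b c →₀ K) →ₗ[K] (Quiver.Path a c →₀ K) :=
  Finsupp.linearCombination K fun p : Quiver.Path a b =>
    Finsupp.lmapDomain K K (fun q : Quiver.Path b c => p.comp q)

@[simp] theorem concat_single {a b c : V} (p : Quiver.Path a b) (q : Quiver.Path b c) (x y : K) :
    concat K a b c (Finsupp.single p x) (Finsupp.single q y) =
      Finsupp.single (p.comp q) (x * y) := by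
  simp [concat, Finsupp.mapDomain_single]

theorem concat_assoc {a b c d : V} (f : Quiver.Path a b →₀ K) (g : Quiver.Path b c →₀ K)
    (h : Quiver.Path c d →₀ K) :
    concat K a c d (concat K a b c f g) h = concat K a b d f (concat K b c d g h) := by
  induction f using Finsupp.induction_linear with
  | zero => simp
  | add f₁ f₂ h₁ h₂ => simp [h₁, h₂]
  | single p x =>
    induction g using Finsupp.induction_linear with
    | zero => simp
    | add g₁ g₂ h₁ h₂ => simp [h₁, h₂]
    | single q y =>
      induction h using Finsupp.induction_linear with
      | zero => simp
      | add g₁ g₂ h₁ h₂ => rw [map_add, map_add, map_add, h₁, h₂]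
      | single r z => simp only [concat_single, Quiver.Path.comp_assoc, mul_assoc]

theorem nil_concat {a b : V} (f : Quiver.Path a b →₀ K) :
    concat K a a b (Finsupp.single Quiver.Path.nil 1) f = f := by
  induction f using Finsupp.induction_linear with
  | zero => simp
  | add f₁ f₂ h₁ h₂ => simp [h₁, h₂]
  | single p x => simp

theorem concat_nil {a b : V} (f : Quiver.Path a b →₀ K) :
    concat K a b b f (Finsupp.single Quiver.Path.nil 1) = f := by
  induction f using Finsupp.induction_linear with
  | zero => simp
  | add f₁ f₂ h₁ h₂ => simp [h₁, h₂]
  | single p x => simp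

open Classical in
/-- A path, as an element of the path algebra. -/
def ofPath {a b : V} (p : Quiver.Path a b) : PathAlgebra K V :=
  Pi.single a (Pi.single b (Finsupp.single p 1))

/-- A vertex, i.e. the trivial path at that vertex, as an element of the path algebra. -/
def vertex (a : V) : PathAlgebra K V := ofPath K (Quiver.Path.nil : Quiver.Path a a)

end Basic

section Apply

variable {K : Type u} {V : Type v} [Field K] [Quiver.{w} V]

theorem add_apply (f g : PathAlgebra K V) (a b : V) : (f + g) a b = f a b + g a b := rfl

theorem zero_apply (a b : V) : (0 : PathAlgebra K V) a b = 0 := rfl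

theorem smul_apply (k : K) (f : PathAlgebra K V) (a b : V) : (k • f) a b = k • f a b := rfl

theorem sum_apply {ι : Type*} (s : Finset ι) (f : ι → PathAlgebra K V) (a b : V) :
    (∑ i ∈ s, f i) a b = ∑ i ∈ s, f i a b := by
  classical
  induction s using Finset.induction_on with
  | empty => rfl
  | insert i s hi ih => rw [Finset.sum_insert hi, Finset.sum_insert hi, add_apply, ih]

end Apply

section Ring

variable {K : Type u} {V : Type v} [Field K] [Quiver.{w} V] [Fintype V]

instance : Mul (PathAlgebra K V) :=
  ⟨fun f g a c => ∑ b : V, concat K a b c (f a b) (g b c)⟩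

instance : One (PathAlgebra K V) := ⟨∑ a : V, vertex K a⟩

theorem mul_apply (f g : PathAlgebra K V) (a c : V) :
    (f * g) a c = ∑ b : V, concat K a b c (f a b) (g b c) := rfl

theorem one_def : (1 : PathAlgebra K V) = ∑ a : V, vertex K a := rfl

theorem one_apply_self (a : V) : (1 : PathAlgebra K V) a a = Finsupp.single Quiver.Path.nil 1 := by
  classical
  rw [one_def, sum_apply, Finset.sum_eq_single a]
  · simp [vertex, ofPath]
  · intro b _ hb
    simp [vertex, ofPath, Pi.single_eq_of_ne (Ne.symm hb)]
  · simp

theorem one_apply_ne {a b : V} (h : a ≠ b) : (1 : PathAlgebra K V) a b = 0 := by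
  classical
  rw [one_def, sum_apply]
  refine Finset.sum_eq_zero fun c _ => ?_
  by_cases hc : a = c
  · subst hc
    simp [vertex, ofPath, Pi.single_eq_of_ne (Ne.symm h)]
  · simp [vertex, ofPath, Pi.single_eq_of_ne hc]

instance : Ring (PathAlgebra K V) where
  __ : AddCommGroup (PathAlgebra K V) := inferInstance
  left_distrib f g h := by
    ext1 a c; simp [mul_apply, add_apply, Finset.sum_add_distrib]
  right_distrib f g h := by
    ext1 a c; simp [mul_apply, add_apply, Finset.sum_add_distrib]
  zero_mul f := by ext1 a c; simp [mul_apply, zero_apply]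
  mul_zero f := by ext1 a c; simp [mul_apply, zero_apply]
  mul_assoc f g h := by
    ext1 a d
    simp only [mul_apply, map_sum, LinearMap.sum_apply, concat_assoc]
    rw [Finset.sum_comm]
  one_mul f := by
    ext1 a c
    rw [mul_apply, Finset.sum_eq_single a, one_apply_self, nil_concat]
    · intro b _ hb
      rw [one_apply_ne (Ne.symm hb)]; simp
    · simp
  mul_one f := by
    ext1 a c
    rw [mul_apply, Finset.sum_eq_single c, one_apply_self, concat_nil]
    · intro b _ hb
      rw [one_apply_ne hb]; simp
    · simp

instance : Algebra K (PathAlgebra K V) :=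
  Algebra.ofModule
    (fun k f g => by ext1 a c; simp [mul_apply, smul_apply, Finset.smul_sum])
    (fun k f g => by ext1 a c; simp [mul_apply, smul_apply, Finset.smul_sum])

/-- An element `x` of the path algebra is uniform if there are vertices `a`, `b` with
`x = a x = x b`. -/
def IsUniform (x : PathAlgebra K V) : Prop :=
  ∃ a b : V, x = vertex K a * x ∧ x = x * vertex K b

/-- The algebra `KQ/I`, where `I = ⟨g⟩` is the two-sided ideal generated by `g`. -/
abbrev Quot (g : Set (PathAlgebra K V)) : Type (max u v w) :=
  (TwoSidedIdeal.span g).ringCon.Quotient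

end Ring

end PathAlgebra

/-! ### The stretched quiver -/

/-- The vertices of the stretched quiver: the vertices of the given quiver and, for each arrow `α`,
new vertices `w_1, …, w_{A-1}`. -/
inductive StretchedQuiver (V : Type v) [Quiver.{w} V] (A : ℕ) : Type (max v w)
  | old (a : V) : StretchedQuiver V A
  | new {a b : V} (α : a ⟶ b) (i : ℕ) (h0 : 0 < i) (hA : i < A) : StretchedQuiver V A

namespace StretchedQuiver

section

variable {V : Type v} [Quiver.{w} V] (A : ℕ)

/-- The vertices passed by the path `α_1 ⋯ α_A` replacing the arrow `α`: the origin of `α` for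
`i = 0`, the vertex `w_i` for `0 < i < A`, and the end of `α` for `i ≥ A` (if `A > 0`). -/
def node {a b : V} (α : a ⟶ b) (i : ℕ) : StretchedQuiver V A :=
  if h0 : i = 0 then old a
  else if hA : i < A then new α i (Nat.pos_of_ne_zero h0) hA
  else old b

theorem node_zero {a b : V} (α : a ⟶ b) : node A α 0 = old a := rfl

theorem node_last [NeZero A] {a b : V} (α : a ⟶ b) : node A α A = old b := by
  simp [node, NeZero.ne A]

/-- The arrows `x ⟶ y` of the stretched quiver: the pairs consisting of an arrow `α` of the given
quiver and `j < A` such that `α_{j+1}`, which starts at the `j`-th and ends at the `j+1`-st node of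
`α`, starts at `x` and ends at `y`. -/
@[ext] structure Arrow (x y : StretchedQuiver V A) : Type (max v w) where
  {src tgt : V}
  arrow : src ⟶ tgt
  idx : Fin A
  node_src : node A arrow idx.1 = x
  node_tgt : node A arrow (idx.1 + 1) = y

instance : Quiver.{max v w} (StretchedQuiver V A) := ⟨Arrow A⟩

/-- The arrow `α_{j+1}`. -/
def seg {a b : V} (α : a ⟶ b) (j : ℕ) (hj : j < A) : node A α j ⟶ node A α (j + 1) :=
  Arrow.mk (A := A) α ⟨j, hj⟩ rfl rfl

/-- The path `α_1 ⋯ α_i`. -/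
def initialPath {a b : V} (α : a ⟶ b) : ∀ i : ℕ, i ≤ A →
    Quiver.Path (old a : StretchedQuiver V A) (node A α i)
  | 0, _ => Quiver.Path.nil
  | i + 1, h => (initialPath α i (Nat.le_of_succ_le h)).cons (seg A α i h)

/-- The path `α_1 ⋯ α_A` replacing the arrow `α`. -/
def arrowPath [NeZero A] {a b : V} (α : a ⟶ b) :
    Quiver.Path (old a : StretchedQuiver V A) (old b) :=
  (initialPath A α A le_rfl).cast rfl (node_last A α)

/-- The path obtained from a path `p` by replacing each arrow `α` by `α_1 ⋯ α_A`. -/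
def stretchPath [NeZero A] {a b : V} (p : Quiver.Path a b) :
    Quiver.Path (old a : StretchedQuiver V A) (old b) :=
  match p with
  | Quiver.Path.nil => Quiver.Path.nil
  | Quiver.Path.cons q α => (stretchPath q).comp (arrowPath A α)

instance [Finite V] [∀ a b : V, Finite (a ⟶ b)] : Finite (StretchedQuiver V A) := by
  let f : V ⊕ (Σ a b : V, (a ⟶ b) × {i : Fin A // 0 < i.1}) → StretchedQuiver V A := fun x =>
    match x with
    | Sum.inl a => old a
    | Sum.inr ⟨_, _, α, i⟩ => new α i.1.1 i.2 i.1.2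
  refine Finite.of_surjective f fun x => ?_
  cases x with
  | old a => exact ⟨Sum.inl a, rfl⟩
  | new α i h0 hA => exact ⟨Sum.inr ⟨_, _, α, ⟨i, hA⟩, h0⟩, rfl⟩

instance [Finite V] [∀ a b : V, Finite (a ⟶ b)] : Fintype (StretchedQuiver V A) :=
  Fintype.ofFinite _

end

end StretchedQuiver

/-! ### The stretched algebra -/

section Stretched

variable {K : Type u} {V : Type v} [Field K] [Quiver.{w} V] (A : ℕ) [NeZero A]

open StretchedQuiver in
/-- The map `θ*` from the path algebra to the path algebra of the stretched quiver: the linear map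
sending each path `p` to the path obtained by replacing each arrow `α` by `α_1 ⋯ α_A`. -/
def thetaStar (f : PathAlgebra K V) : PathAlgebra K (StretchedQuiver V A)
  | old a, old b => Finsupp.mapDomain (fun p : Quiver.Path a b => stretchPath A p) (f a b)
  | _, _ => 0

variable [Fintype V] [∀ a b : V, Finite (a ⟶ b)] (g : Set (PathAlgebra K V))

/-- The stretched algebra of `KQ/⟨g⟩`. -/
abbrev StretchedAlgebra : Type (max u v w) :=
  PathAlgebra.Quot (thetaStar A '' g)

/-- The sum `ε` of the old vertices, as an element of the stretched algebra. -/
def stretchedIdempotent : StretchedAlgebra A g :=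
  ((∑ a : V, PathAlgebra.vertex K (StretchedQuiver.old a : StretchedQuiver V A) :
    PathAlgebra K (StretchedQuiver V A)) : StretchedAlgebra A g)

theorem PathAlgebra.vertex_apply_self {W : Type v} [Quiver.{w} W] (a : W) :
    vertex K a a a = Finsupp.single Quiver.Path.nil 1 := by
  simp [vertex, ofPath]

theorem PathAlgebra.vertex_apply_ne {W : Type v} [Quiver.{w} W] {a b c : W}
    (h : b ≠ a ∨ c ≠ a) : vertex K a b c = 0 := by
  classical
  by_cases hb : b = a
  · subst hb
    have hc : c ≠ b := by simpa using h
    simp [vertex, ofPath, Pi.single_eq_of_ne hc]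
  · simp [vertex, ofPath, Pi.single_eq_of_ne hb]

theorem PathAlgebra.vertex_mul_self {W : Type v} [Quiver.{w} W] [Fintype W] (a : W) :
    vertex K a * vertex K a = vertex K a := by
  ext1 b c
  rw [mul_apply, Finset.sum_eq_single a]
  · by_cases hb : b = a
    · subst hb
      rw [vertex_apply_self, nil_concat]
    · rw [vertex_apply_ne (Or.inl hb), vertex_apply_ne (Or.inl hb)]; simp
  · intro d _ hd
    rw [vertex_apply_ne (Or.inr hd)]; simp
  · simp

theorem PathAlgebra.vertex_mul_of_ne {W : Type v} [Quiver.{w} W] [Fintype W] {a b : W}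
    (h : a ≠ b) : vertex K a * vertex K b = 0 := by
  ext1 c d
  rw [mul_apply, zero_apply]
  refine Finset.sum_eq_zero fun x _ => ?_
  by_cases hx : x = a
  · subst hx
    rw [vertex_apply_ne (a := b) (Or.inl h)]; simp
  · rw [vertex_apply_ne (Or.inr hx)]; simp

theorem stretchedIdempotent_isIdempotentElem : IsIdempotentElem (stretchedIdempotent A g) := by
  unfold IsIdempotentElem stretchedIdempotent
  rw [← RingCon.coe_mul]
  congr 1
  rw [Finset.sum_mul]
  refine Finset.sum_congr rfl fun a _ => ?_
  rw [Finset.mul_sum, Finset.sum_eq_single a, PathAlgebra.vertex_mul_self]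
  · intro b _ hb
    exact PathAlgebra.vertex_mul_of_ne fun h => hb (StretchedQuiver.old.inj h).symm
  · simp

end Stretched

/-! ### Finite-dimensional right modules -/

section Modules

open scoped ModuleCat

section FinDim

variable (K : Type u) [Field K] (R : Type v) [Ring R] [Algebra K R]

/-- The modules over the `K`-algebra `R` that are finite-dimensional over `K`. -/
def isFinDim : ObjectProperty (ModuleCat.{v} R) := fun M => FiniteDimensional K M

instance : (isFinDim K R).ContainsZero where
  exists_zero := by
    refine ⟨ModuleCat.of R PUnit, ModuleCat.isZero_of_subsingleton _, ?_⟩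
    have : Finite (ModuleCat.of R PUnit.{v + 1}) := inferInstanceAs (Finite PUnit)
    exact Module.Finite.of_finite

instance : (isFinDim K R).IsClosedUnderSubobjects where
  prop_of_mono {M N} f hf hN := by
    have : FiniteDimensional K N := hN
    exact Module.Finite.of_injective (f.hom.restrictScalars K)
      ((ModuleCat.mono_iff_injective f).1 hf)

instance : (isFinDim K R).IsClosedUnderQuotients where
  prop_of_epi {M N} f hf hM := by
    have : FiniteDimensional K M := hM
    exact Module.Finite.of_surjective (f.hom.restrictScalars K)
      ((ModuleCat.epi_iff_surjective f).1 hf)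

instance : (isFinDim K R).IsClosedUnderFiniteProducts where
  isClosedUnderLimitsOfShape J _ := ⟨by
    rintro X ⟨p⟩
    have : ∀ j : J, FiniteDimensional K (p.diag.obj ⟨j⟩) := fun j => p.prop_diag_obj ⟨j⟩
    refine Module.Finite.of_injective
      (LinearMap.pi fun j : J => ((p.π.app ⟨j⟩).hom.restrictScalars K)) fun x y h => ?_
    refine Limits.Concrete.isLimit_ext _ p.isLimit x y fun j => ?_
    exact congrFun h j.as⟩

theorem isFinDim_of {M : Type v} [AddCommGroup M] [Module R M] [Module K M] [IsScalarTower K R M]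
    [h : FiniteDimensional K M] : isFinDim K R (ModuleCat.of R M) := by
  have key : Module.restrictScalars K R M = (inferInstance : Module K M) := by
    refine Module.ext' _ _ fun k m => ?_
    exact algebraMap_smul R k m
  change @Module.Finite K M _ _ (Module.restrictScalars K R M)
  rw [key]
  exact h

/-- The category `mod R` of finite-dimensional right modules over the `K`-algebra `R`.  Right
modules are modules over the opposite algebra. -/
abbrev FinDimMod := (isFinDim K Rᵐᵒᵖ).FullSubcategory

/-- The finite-dimensional algebra `R` as a right module over itself. -/
def FinDimMod.regular [FiniteDimensional K R] : FinDimMod K R :=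
  haveI : IsScalarTower K Rᵐᵒᵖ R := ⟨fun k a x => by
    change x * (k • a.unop) = k • (x * a.unop)
    exact mul_smul_comm k x a.unop⟩
  ⟨ModuleCat.of Rᵐᵒᵖ R, isFinDim_of K Rᵐᵒᵖ⟩

end FinDim

/-! ### The functor `res_e = (-)e` -/

section Corner

variable {R : Type v} [Ring R] {e : R} (he : IsIdempotentElem e)

/-- For a right `R`-module `M`, the subgroup `Me = {m | m e = m}`. -/
def rightCorner (e : R) (M : Type w) [AddCommGroup M] [Module Rᵐᵒᵖ M] : AddSubgroup M where
  carrier := {m | op e • m = m}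
  add_mem' {a b} ha hb := by
    simp only [Set.mem_ofPred_eq] at *
    rw [smul_add, ha, hb]
  zero_mem' := smul_zero _
  neg_mem' {a} ha := by
    simp only [Set.mem_ofPred_eq] at *
    rw [smul_neg, ha]

/-- For a left `R`-module `M`, the subgroup `eM = {m | e m = m}`. -/
def leftCorner (e : R) (M : Type w) [AddCommGroup M] [Module R M] : AddSubgroup M where
  carrier := {m | e • m = m}
  add_mem' {a b} ha hb := by
    simp only [Set.mem_ofPred_eq] at *
    rw [smul_add, ha, hb]
  zero_mem' := smul_zero _
  neg_mem' {a} ha := by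
    simp only [Set.mem_ofPred_eq] at *
    rw [smul_neg, ha]

theorem IsIdempotentElem.Corner.mul_idem (b : he.Corner) : b.1 * e = b.1 :=
  ((Subsemigroup.mem_corner_iff he).1 b.2).2

theorem IsIdempotentElem.Corner.idem_mul (b : he.Corner) : e * b.1 = b.1 :=
  ((Subsemigroup.mem_corner_iff he).1 b.2).1

/-- `Me` is a right `eRe`-module. -/
instance rightCorner.module (M : Type w) [AddCommGroup M] [Module Rᵐᵒᵖ M] :
    Module he.Cornerᵐᵒᵖ (rightCorner e M) where
  smul b m := ⟨op b.unop.1 • m.1, by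
    change op e • op b.unop.1 • m.1 = op b.unop.1 • m.1
    rw [smul_smul, ← op_mul, IsIdempotentElem.Corner.mul_idem he]⟩
  one_smul m := Subtype.ext m.2
  mul_smul a b m := Subtype.ext (mul_smul (op a.unop.1) (op b.unop.1) m.1)
  smul_zero a := Subtype.ext (smul_zero (op a.unop.1))
  smul_add a m n := Subtype.ext (smul_add (op a.unop.1) m.1 n.1)
  add_smul a b m := Subtype.ext (add_smul (op a.unop.1) (op b.unop.1) m.1)
  zero_smul m := Subtype.ext (zero_smul Rᵐᵒᵖ m.1)

/-- `eM` is a left `eRe`-module. -/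
instance leftCorner.module (M : Type w) [AddCommGroup M] [Module R M] :
    Module he.Corner (leftCorner e M) where
  smul b m := ⟨b.1 • m.1, by
    change e • b.1 • m.1 = b.1 • m.1
    rw [smul_smul, IsIdempotentElem.Corner.idem_mul he]⟩
  one_smul m := Subtype.ext m.2
  mul_smul a b m := Subtype.ext (mul_smul a.1 b.1 m.1)
  smul_zero a := Subtype.ext (smul_zero a.1)
  smul_add a m n := Subtype.ext (smul_add a.1 m.1 n.1)
  add_smul a b m := Subtype.ext (add_smul a.1 b.1 m.1)
  zero_smul m := Subtype.ext (zero_smul R m.1)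

theorem rightCorner.coe_smul {M : Type w} [AddCommGroup M] [Module Rᵐᵒᵖ M] (b : he.Cornerᵐᵒᵖ)
    (m : rightCorner e M) : ((b • m : rightCorner e M) : M) = op b.unop.1 • (m : M) := rfl

theorem leftCorner.coe_smul {M : Type w} [AddCommGroup M] [Module R M] (b : he.Corner)
    (m : leftCorner e M) : ((b • m : leftCorner e M) : M) = b.1 • (m : M) := rfl

/-- The map `Me → Ne` induced by a homomorphism `M → N` of right modules. -/
def rightCorner.map {M N : Type w} [AddCommGroup M] [Module Rᵐᵒᵖ M] [AddCommGroup N]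
    [Module Rᵐᵒᵖ N] (f : M →ₗ[Rᵐᵒᵖ] N) : rightCorner e M →ₗ[he.Cornerᵐᵒᵖ] rightCorner e N where
  toFun m := ⟨f m.1, by
    change op e • f m.1 = f m.1
    rw [← map_smul, show op e • m.1 = m.1 from m.2]⟩
  map_add' m n := Subtype.ext (map_add f m.1 n.1)
  map_smul' b m := Subtype.ext (map_smul f (op b.unop.1) m.1)

variable (K : Type u) [Field K] [Algebra K R]

/-- `eRe` is a `K`-algebra. -/
instance IsIdempotentElem.Corner.algebra : Algebra K he.Corner where
  smul k b := ⟨k • b.1, (Subsemigroup.mem_corner_iff he).2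
    ⟨by rw [mul_smul_comm, IsIdempotentElem.Corner.idem_mul he],
      by rw [smul_mul_assoc, IsIdempotentElem.Corner.mul_idem he]⟩⟩
  algebraMap :=
    { toFun := fun k => ⟨k • e, (Subsemigroup.mem_corner_iff he).2
        ⟨by rw [mul_smul_comm, he.eq], by rw [smul_mul_assoc, he.eq]⟩⟩
      map_one' := Subtype.ext (one_smul K e)
      map_mul' := fun k l => Subtype.ext (by
        change (k * l) • e = (k • e) * (l • e)
        rw [smul_mul_smul_comm, he.eq])
      map_zero' := Subtype.ext (zero_smul K e)
      map_add' := fun k l => Subtype.ext (add_smul k l e) }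
  commutes' k b := Subtype.ext (by
    change (k • e) * b.1 = b.1 * (k • e)
    rw [smul_mul_assoc, mul_smul_comm, IsIdempotentElem.Corner.idem_mul he,
      IsIdempotentElem.Corner.mul_idem he])
  smul_def' k b := Subtype.ext (by
    change k • b.1 = (k • e) * b.1
    rw [smul_mul_assoc, IsIdempotentElem.Corner.idem_mul he])

/-- The functor `res_e : mod R ⥤ mod eRe`, `M ↦ Me`. -/
def resFunctor : FinDimMod K R ⥤ FinDimMod K he.Corner where
  obj M := ⟨ModuleCat.of he.Cornerᵐᵒᵖ (rightCorner e M.obj), by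
    have : FiniteDimensional K M.obj := M.property
    let _ : Module K (rightCorner e M.obj) := Module.restrictScalars K he.Cornerᵐᵒᵖ _
    change Module.Finite K (rightCorner e M.obj)
    let f : rightCorner e M.obj →ₗ[K] M.obj :=
      { toFun := fun m => m.1
        map_add' := fun _ _ => rfl
        map_smul' := fun k m => by
          change op (k • e) • m.1 = op (algebraMap K R k) • m.1
          rw [Algebra.smul_def, Algebra.commutes, op_mul, mul_smul,
            show op e • m.1 = m.1 from m.2] }
    exact Module.Finite.of_injective f fun x y h => Subtype.ext h⟩
  map f := ObjectProperty.homMk (ModuleCat.ofHom (rightCorner.map he f.hom.hom))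

end Corner

end Modules

/-! ### Homological isomorphisms -/

section HomologicalIso

universe v₁ v₂ u₁ u₂

variable {B : Type u₁} [Category.{v₁} B] [Abelian B] {C : Type u₂} [Category.{v₂} C] [Abelian C]

/-- A functor `F : B ⥤ C` between abelian categories is a `t`-homological isomorphism if for all
objects `X`, `Y` of `B` and all `j > t` there is a group isomorphism
`Ext^j(X, Y) ≅ Ext^j(F X, F Y)`, which need not be induced by `F`. -/
def IsHomologicalIso (F : B ⥤ C) (t : ℤ) : Prop :=
  letI := HasExt.standard B
  letI := HasExt.standard C
  ∀ (X Y : B) (j : ℕ), t < j →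
    Nonempty (Abelian.Ext X Y j ≃+ Abelian.Ext (F.obj X) (F.obj Y) j)

/-- An eventually homological isomorphism is a `t`-homological isomorphism for some `t`. -/
def IsEventuallyHomologicalIso (F : B ⥤ C) : Prop :=
  ∃ t : ℤ, IsHomologicalIso F t

end HomologicalIso

/-! ### Stratifying ideals -/

section Stratifying

/-- The subgroup of `M ⊗[ℤ] N` generated by the elements `mb ⊗ n - m ⊗ bn`. -/
def balancedRelations (B : Type v) [Ring B] (M N : Type v) [AddCommGroup M] [Module Bᵐᵒᵖ M]
    [AddCommGroup N] [Module B N] : AddSubgroup (M ⊗[ℤ] N) :=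
  AddSubgroup.closure
    {z | ∃ (m : M) (b : B) (n : N), z = (op b • m) ⊗ₜ[ℤ] n - m ⊗ₜ[ℤ] (b • n)}

/-- The tensor product `M ⊗_B N` of a right module and a left module over a ring `B` that need not
be commutative. -/
abbrev BalancedTensor (B : Type v) [Ring B] (M N : Type v) [AddCommGroup M] [Module Bᵐᵒᵖ M]
    [AddCommGroup N] [Module B N] : Type v :=
  (M ⊗[ℤ] N) ⧸ balancedRelations B M N

theorem BalancedTensor.hom_ext {B : Type v} [Ring B] {M N : Type v} [AddCommGroup M]
    [Module Bᵐᵒᵖ M] [AddCommGroup N] [Module B N] {G : Type v} [AddCommGroup G]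
    {f g : BalancedTensor B M N →+ G}
    (h : ∀ (m : M) (n : N), f (QuotientAddGroup.mk (m ⊗ₜ[ℤ] n)) =
      g (QuotientAddGroup.mk (m ⊗ₜ[ℤ] n))) : f = g := by
  ext z
  induction z using TensorProduct.induction_on with
  | zero => rw [map_zero, map_zero]
  | tmul m n => exact h m n
  | add a b ha hb => rw [map_add, map_add, ha, hb]

/-- The map `M ⊗_B N → M' ⊗_B N` induced by a homomorphism `M → M'` of right modules. -/
def BalancedTensor.map {B : Type v} [Ring B] {M M' : Type v} (N : Type v) [AddCommGroup M]
    [Module Bᵐᵒᵖ M] [AddCommGroup M'] [Module Bᵐᵒᵖ M'] [AddCommGroup N] [Module B N]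
    (f : M →ₗ[Bᵐᵒᵖ] M') : BalancedTensor B M N →+ BalancedTensor B M' N :=
  QuotientAddGroup.map _ _
    (TensorProduct.map f.toAddMonoidHom.toIntLinearMap LinearMap.id).toAddMonoidHom (by
      refine (AddSubgroup.closure_le _).2 ?_
      rintro _ ⟨m, b, n, rfl⟩
      refine AddSubgroup.subset_closure ⟨f m, b, n, ?_⟩
      simp)

/-- The functor `- ⊗_B N` from right `B`-modules to abelian groups. -/
def tensorFunctor (B : Type v) [Ring B] (N : Type v) [AddCommGroup N] [Module B N] :
    ModuleCat.{v} Bᵐᵒᵖ ⥤ AddCommGrpCat.{v} where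
  obj M := AddCommGrpCat.of (BalancedTensor B M N)
  map f := AddCommGrpCat.ofHom (BalancedTensor.map N f.hom)
  map_id M := by
    refine AddCommGrpCat.hom_ext (BalancedTensor.hom_ext fun m n => rfl)
  map_comp f g := by
    refine AddCommGrpCat.hom_ext (BalancedTensor.hom_ext fun m n => rfl)

instance (B : Type v) [Ring B] (N : Type v) [AddCommGroup N] [Module B N] :
    (tensorFunctor B N).Additive where
  map_add {X Y f g} := by
    refine AddCommGrpCat.hom_ext (BalancedTensor.hom_ext fun m n => ?_)
    exact congrArg _ (TensorProduct.add_tmul (f.hom m) (g.hom m) n)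

/-- `Tor_n^B(M, N)` for a right module `M` and a left module `N`. -/
def TorGroup (B : Type v) [Ring B] (n : ℕ) (M N : Type v) [AddCommGroup M] [Module Bᵐᵒᵖ M]
    [AddCommGroup N] [Module B N] : AddCommGrpCat.{v} :=
  ((tensorFunctor B N).leftDerived n).obj (ModuleCat.of Bᵐᵒᵖ M)

variable {R : Type v} [Ring R] {e : R} (he : IsIdempotentElem e)

/-- The multiplication map `Re ⊗_{eRe} eR → R`. -/
def cornerMul : BalancedTensor he.Corner (rightCorner e R) (leftCorner e R) →+ R :=
  QuotientAddGroup.lift _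
    (TensorProduct.lift ((LinearMap.mul ℤ R).domRestrict₁₂
      (rightCorner e R).toIntSubmodule (leftCorner e R).toIntSubmodule)).toAddMonoidHom (by
      refine (AddSubgroup.closure_le _).2 ?_
      rintro _ ⟨m, b, n, rfl⟩
      refine (map_sub _ _ _).trans ?_
      change (m.1 * b.1) * n.1 - m.1 * (b.1 * n.1) = 0
      rw [mul_assoc, sub_self])

theorem cornerMul_tmul (x : rightCorner e R) (y : leftCorner e R) :
    cornerMul he (QuotientAddGroup.mk (x ⊗ₜ[ℤ] y)) = x.1 * y.1 := rfl

/-- For an idempotent `e`, the two-sided ideal `ReR` is a stratifying ideal if the multiplication map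
`Re ⊗_{eRe} eR → ReR` is an isomorphism and `Tor_n^{eRe}(Re, eR) = 0` for all `n > 0`. -/
structure IsStratifyingIdeal : Prop where
  mul_injective : Function.Injective (cornerMul he)
  range_mul : Set.range (cornerMul he) = (TwoSidedIdeal.span {e} : TwoSidedIdeal R)
  tor_eq_zero : ∀ n : ℕ, 0 < n →
    Limits.IsZero (TorGroup he.Corner n (rightCorner e R) (leftCorner e R))

end Stratifying

end

/-! Write R for the stretched algebra and e for its idempotent `stretchedIdempotent`. Everything
rests on how the new vertices sit in R. Exactly one arrow a starts at a new vertex w; it leads to a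
vertex h, and a can be cancelled on the left, so aR ≅ hR and wR = Kw + aR. On the other side, the
paths from old vertices to w all end in one initial segment i starting at an old vertex c, and i can
be cancelled on the right, so eRc ≅ eRw. Moreover θ* induces an isomorphism from the given algebra
to eRe (`StretchedAlgebra.cornerEquiv`). Spanning follows by multiplying normal forms by arrows;
cancellation and injectivity follow from explicit matrix representations of the stretched quiver
that respect the relations. `SegmentData` records these facts, and the remaining argument uses only
them.

Composing arrows along a segment gives, for each w, one path from w back to eRe. Hence Re is the sum
of eRe and the modules wRe ≅ dRe with d an idempotent of eRe, so Re is projective over eRe. This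
makes Tor vanish, and the resulting normal form in Re ⊗ eR makes multiplication injective
(`SegmentData.isStratifyingIdeal`).

For Ext, let X be a right R-module. A module annihilated by e is an iterated extension of simples
wR/aR, each resolved by 0 → hR → wR, so its projective dimension is at most one
(`SegmentData.hasProjectiveDimensionLT_of_annihilated`). Thus in high degrees X may be replaced by
XeR, and XeR by a module G mapping onto it with kernel annihilated by e, such that GeR = G and each
i acts injectively on Gc. On such G the functor (-)e is fully faithful against every module, the
class is closed under kernels of covers by copies of eR, and (eR)e = eRe is projective; dimension
shifting compares Ext (`SegmentData.mapExt_bijective_of_isReflected`, `SegmentData.ext_iso`).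
Replacing XeR by G costs the extra degree that gives the bound 2.

For injective dimensions, Re is a direct summand of a finite sum of copies of eRe, and Ext into R is
Ext into Re in degrees above 2. -/

/-! ### Representing quivers in rings: maps out of path algebras and their quotients -/

/-- Elements of a ring assigned to the vertices and arrows of a quiver which satisfy the defining
relations of the path algebra, except possibly that the vertices sum up to `1`. -/
structure QuiverRealization (V : Type*) [Quiver V] (B : Type*) [Ring B] where
  vert : V → B
  arr : ∀ {a b : V}, (a ⟶ b) → B
  vert_mul_self : ∀ a, vert a * vert a = vert a
  vert_mul_of_ne : ∀ {a b}, a ≠ b → vert a * vert b = 0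
  vert_mul_arr : ∀ {a b : V} (α : a ⟶ b), vert a * arr α = arr α
  arr_mul_vert : ∀ {a b : V} (α : a ⟶ b), arr α * vert b = arr α

namespace QuiverRealization

variable {V : Type*} [Quiver V] {B : Type*} [Ring B] (ρ : QuiverRealization V B)

/-- The product of the elements assigned to the arrows of a path. -/
def path {a : V} : ∀ {b : V}, Quiver.Path a b → B
  | _, Quiver.Path.nil => ρ.vert a
  | _, Quiver.Path.cons p α => path p * ρ.arr α

@[simp] theorem path_nil (a : V) : ρ.path (Quiver.Path.nil : Quiver.Path a a) = ρ.vert a := rfl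

@[simp] theorem path_cons {a b c : V} (p : Quiver.Path a b) (α : b ⟶ c) :
    ρ.path (p.cons α) = ρ.path p * ρ.arr α := rfl

theorem path_mul_vert {a b : V} (p : Quiver.Path a b) : ρ.path p * ρ.vert b = ρ.path p := by
  cases p with
  | nil => exact ρ.vert_mul_self a
  | cons p α => rw [path_cons, mul_assoc, arr_mul_vert]

theorem vert_mul_path {a b : V} (p : Quiver.Path a b) : ρ.vert a * ρ.path p = ρ.path p := by
  induction p with
  | nil => exact ρ.vert_mul_self a
  | cons p α ih => rw [path_cons, ← mul_assoc, ih]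

theorem path_comp {a b c : V} (p : Quiver.Path a b) (q : Quiver.Path b c) :
    ρ.path (p.comp q) = ρ.path p * ρ.path q := by
  induction q with
  | nil => exact (ρ.path_mul_vert p).symm
  | cons q α ih => rw [Quiver.Path.comp_cons, path_cons, path_cons, ih, mul_assoc]

theorem path_mul_path_of_ne {a b c d : V} (p : Quiver.Path a b) (q : Quiver.Path c d)
    (h : b ≠ c) : ρ.path p * ρ.path q = 0 := by
  rw [← ρ.path_mul_vert p, ← ρ.vert_mul_path q, mul_assoc, ← mul_assoc (ρ.vert b),
    ρ.vert_mul_of_ne h, zero_mul, mul_zero]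

theorem path_cast {a b c d : V} (h : a = c) (h' : b = d) (p : Quiver.Path a b) :
    ρ.path (p.cast h h') = ρ.path p := by
  subst h h'
  rfl

end QuiverRealization

namespace PathAlgebra

variable {K : Type u} {V : Type v} [Field K] [Quiver.{w} V]

theorem ofPath_apply_self {a b : V} (p : Quiver.Path a b) :
    ofPath K p a b = Finsupp.single p 1 := by
  simp [ofPath]

theorem ofPath_apply_ne {a b c d : V} (p : Quiver.Path a b) (h : c ≠ a ∨ d ≠ b) :
    ofPath K p c d = 0 := by
  classical
  by_cases hc : c = a
  · subst hc
    have hd : d ≠ b := by simpa using h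
    simp [ofPath, Pi.single_eq_of_ne hd]
  · simp [ofPath, Pi.single_eq_of_ne hc]

/-- The coefficients of an element at the paths from `a` to `b`. -/
def coeff (K : Type u) {V : Type v} [Field K] [Quiver.{w} V] (a b : V) :
    PathAlgebra K V →ₗ[K] Quiver.Path a b →₀ K where
  toFun f := f a b
  map_add' _ _ := rfl
  map_smul' _ _ := rfl

@[simp] theorem coeff_apply (a b : V) (f : PathAlgebra K V) : coeff K a b f = f a b := rfl

open Classical in
/-- The element of the path algebra with given coefficients at the paths from `a` to `b`. -/
noncomputable def single (K : Type u) {V : Type v} [Field K] [Quiver.{w} V] (a b : V) :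
    (Quiver.Path a b →₀ K) →ₗ[K] PathAlgebra K V where
  toFun x := Pi.single a (Pi.single b x)
  map_add' x y := by
    rw [Pi.single_add, Pi.single_add]
    rfl
  map_smul' k x := by
    rw [Pi.single_smul, Pi.single_smul]
    rfl

theorem single_apply_self (a b : V) (x : Quiver.Path a b →₀ K) : single K a b x a b = x := by
  classical
  change (Pi.single a (Pi.single b x) : ∀ c d : V, Quiver.Path c d →₀ K) a b = x
  rw [Pi.single_eq_same, Pi.single_eq_same]

theorem single_apply_ne {a b c d : V} (x : Quiver.Path a b →₀ K) (h : c ≠ a ∨ d ≠ b) :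
    single K a b x c d = 0 := by
  classical
  change (Pi.single a (Pi.single b x) : ∀ c d : V, Quiver.Path c d →₀ K) c d = 0
  by_cases hc : c = a
  · subst hc
    have hd : d ≠ b := by simpa using h
    rw [Pi.single_eq_same, Pi.single_eq_of_ne hd]
  · rw [Pi.single_eq_of_ne hc, Pi.zero_apply]

theorem single_single (a b : V) (p : Quiver.Path a b) (k : K) :
    single K a b (Finsupp.single p k) = k • ofPath K p := by
  rw [← mul_one k, ← smul_eq_mul, ← Finsupp.smul_single, map_smul, smul_eq_mul, mul_one]
  rfl

theorem sum_single [Fintype V] (f : PathAlgebra K V) :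
    ∑ a : V, ∑ b : V, single K a b (f a b) = f := by
  ext1 a b
  rw [sum_apply, Finset.sum_eq_single a, sum_apply, Finset.sum_eq_single b]
  · exact single_apply_self a b _
  · exact fun c _ hc => single_apply_ne _ (Or.inr (Ne.symm hc))
  · simp
  · intro c _ hc
    rw [sum_apply]
    exact Finset.sum_eq_zero fun d _ => single_apply_ne _ (Or.inl (Ne.symm hc))
  · simp

theorem linearMap_ext [Finite V] {M : Type*} [AddCommGroup M] [Module K M]
    {F G : PathAlgebra K V →ₗ[K] M}
    (h : ∀ (a b : V) (p : Quiver.Path a b), F (ofPath K p) = G (ofPath K p)) : F = G := by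
  have := Fintype.ofFinite V
  have key : ∀ a b : V, F ∘ₗ single K a b = G ∘ₗ single K a b := fun a b =>
    Finsupp.lhom_ext fun p k => by
      rw [LinearMap.comp_apply, LinearMap.comp_apply, single_single, map_smul, map_smul, h]
  ext f
  rw [← sum_single f, map_sum, map_sum]
  refine Finset.sum_congr rfl fun a _ => ?_
  rw [map_sum, map_sum]
  exact Finset.sum_congr rfl fun b _ => congr($(key a b) (f a b))

variable [Fintype V]

theorem ofPath_mul_ofPath {a b c : V} (p : Quiver.Path a b) (q : Quiver.Path b c) :
    ofPath K p * ofPath K q = ofPath K (p.comp q) := by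
  ext1 x y
  rw [mul_apply, Finset.sum_eq_single b]
  · by_cases hx : x = a
    · subst hx
      by_cases hy : y = c
      · subst hy
        simp [ofPath_apply_self]
      · simp [ofPath_apply_ne _ (Or.inr hy)]
    · simp [ofPath_apply_ne _ (Or.inl hx)]
  · intro d _ hd
    simp [ofPath_apply_ne _ (Or.inr hd)]
  · simp

theorem ofPath_mul_ofPath_of_ne {a b c d : V} (p : Quiver.Path a b) (q : Quiver.Path c d)
    (h : b ≠ c) : ofPath K p * ofPath K q = 0 := by
  ext1 x y
  rw [mul_apply, zero_apply]
  refine Finset.sum_eq_zero fun e _ => ?_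
  by_cases he : e = b
  · subst he
    simp [ofPath_apply_ne _ (Or.inl h)]
  · simp [ofPath_apply_ne _ (Or.inr he)]

variable (K V) in
/-- The vertices and arrows of a quiver as elements of its path algebra. -/
noncomputable def realization : QuiverRealization V (PathAlgebra K V) where
  vert := vertex K
  arr α := ofPath K α.toPath
  vert_mul_self a := ofPath_mul_ofPath _ _
  vert_mul_of_ne h := ofPath_mul_ofPath_of_ne _ _ h
  vert_mul_arr α := (ofPath_mul_ofPath _ _).trans (by rw [Quiver.Path.nil_comp])
  arr_mul_vert α := ofPath_mul_ofPath _ _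

theorem realization_path {a b : V} (p : Quiver.Path a b) :
    (realization K V).path p = ofPath K p := by
  induction p with
  | nil => rfl
  | cons p α ih =>
    rw [QuiverRealization.path_cons, ih]
    exact ofPath_mul_ofPath _ _

section Lift

variable {B : Type*} [Ring B] [Algebra K B] (ρ : QuiverRealization V B)

/-- The linear map which sends a path to the product of the elements assigned to its arrows. -/
noncomputable def liftLinear : PathAlgebra K V →ₗ[K] B :=
  ∑ a : V, ∑ b : V, Finsupp.linearCombination K (fun p : Quiver.Path a b => ρ.path p) ∘ₗ coeff K a b

@[simp] theorem liftLinear_ofPath {a b : V} (p : Quiver.Path a b) :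
    liftLinear ρ (ofPath K p) = ρ.path p := by
  simp only [liftLinear, LinearMap.sum_apply, LinearMap.comp_apply]
  rw [Finset.sum_eq_single a, Finset.sum_eq_single b]
  · simp [ofPath_apply_self]
  · intro c _ hc
    simp [ofPath_apply_ne p (Or.inr hc)]
  · simp
  · intro c _ hc
    simp [ofPath_apply_ne p (Or.inl hc)]
  · simp

/-- Both sides are bilinear, so it suffices to test paths, where non-composable pairs die because
distinct vertices are orthogonal. The map need not preserve 1, since the vertices need not sum to 1;
hence it is kept as a linear map. -/
theorem liftLinear_mul (f h : PathAlgebra K V) :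
    liftLinear ρ (f * h) = liftLinear ρ f * liftLinear ρ h := by
  have : (LinearMap.mul K _).compr₂ (liftLinear ρ) =
      (LinearMap.mul K B).compl₁₂ (liftLinear ρ) (liftLinear ρ) := by
    refine linearMap_ext fun a b p => linearMap_ext fun c d q => ?_
    simp only [LinearMap.compr₂_apply, LinearMap.mul_apply', LinearMap.compl₁₂_apply,
      liftLinear_ofPath]
    by_cases hbc : b = c
    · subst hbc
      rw [ofPath_mul_ofPath, liftLinear_ofPath, ρ.path_comp]
    · rw [ofPath_mul_ofPath_of_ne _ _ hbc, map_zero, ρ.path_mul_path_of_ne _ _ hbc]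
  exact congr($this f h)

end Lift

section Quot

variable (g : Set (PathAlgebra K V))

/-- The projection from the path algebra to its quotient. -/
noncomputable def quotMk : PathAlgebra K V →ₐ[K] Quot g :=
  { (TwoSidedIdeal.span g).ringCon.mk' with commutes' := fun _ => rfl }

theorem quotMk_surjective : Function.Surjective (quotMk g) :=
  RingCon.mk'_surjective _

theorem quotMk_eq_zero_iff {f : PathAlgebra K V} :
    quotMk g f = 0 ↔ f ∈ TwoSidedIdeal.span g := by
  conv_rhs => rw [← TwoSidedIdeal.ker_ringCon_mk' (TwoSidedIdeal.span g), TwoSidedIdeal.mem_ker]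
  rfl

variable {g} in
theorem quotMk_eq_zero {f : PathAlgebra K V} (hf : f ∈ g) : quotMk g f = 0 :=
  (quotMk_eq_zero_iff g).2 (TwoSidedIdeal.subset_span hf)

variable {B : Type*} [Ring B] [Algebra K B]

/-- The universal property of the quotient of the path algebra. -/
noncomputable def quotLift (F : PathAlgebra K V →ₐ[K] B) (hF : ∀ f ∈ g, F f = 0) :
    Quot g →ₐ[K] B :=
  { RingCon.lift (TwoSidedIdeal.span g).ringCon F.toRingHom (by
      have h : TwoSidedIdeal.span g ≤ TwoSidedIdeal.ker F :=
        TwoSidedIdeal.span_le.2 fun f hf => (TwoSidedIdeal.mem_ker F).2 (hF f hf)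
      exact fun x y hxy => ((TwoSidedIdeal.ker F).rel_iff x y).2 (h (((TwoSidedIdeal.span g).rel_iff x y).1 hxy))) with
    commutes' := fun k => F.commutes k }

end Quot

end PathAlgebra

namespace PathAlgebra

variable {K : Type u} {V : Type v} [Field K] [Quiver.{w} V] [Fintype V]
  {B : Type*} [Ring B] [Algebra K B]

/-- The map is not assumed unital, so the universal property of the quotient is not available;
multiplicativity still makes vanishing pass from generators to the whole ideal. -/
theorem liftLinear_eq_zero (ρ : QuiverRealization V B) {g : Set (PathAlgebra K V)}
    (hg : ∀ f ∈ g, liftLinear ρ f = 0) {f : PathAlgebra K V}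
    (hf : f ∈ TwoSidedIdeal.span g) : liftLinear ρ f = 0 := by
  induction hf using TwoSidedIdeal.span_induction with
  | mem f hf => exact hg f hf
  | zero => exact map_zero _
  | add x y _ _ hx hy => rw [map_add, hx, hy, add_zero]
  | neg x _ hx => rw [map_neg, hx, neg_zero]
  | left_absorb a x _ hx => rw [liftLinear_mul, hx, mul_zero]
  | right_absorb a x _ hx => rw [liftLinear_mul, hx, zero_mul]

/-- A subspace of a quotient of the path algebra which contains the vertices and is closed under
right multiplication by arrows is everything. -/
theorem quot_eq_top_of_mul_arrow_mem (g : Set (PathAlgebra K V)) (S : Submodule K (Quot g))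
    (hv : ∀ a : V, quotMk g (vertex K a) ∈ S)
    (ha : ∀ (a b : V) (α : a ⟶ b), ∀ s ∈ S, s * quotMk g (ofPath K α.toPath) ∈ S)
    (r : Quot g) : r ∈ S := by
  have key : ∀ (a b : V) (p : Quiver.Path a b), quotMk g (ofPath K p) ∈ S := by
    intro a b p
    induction p with
    | nil => exact hv a
    | cons p α ih =>
      have := ha _ _ α _ ih
      rwa [← map_mul, ofPath_mul_ofPath] at this
  obtain ⟨f, rfl⟩ := quotMk_surjective g r
  have : S.mkQ ∘ₗ (quotMk g).toLinearMap = 0 := linearMap_ext fun a b p => by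
    rw [LinearMap.comp_apply, LinearMap.zero_apply, Submodule.mkQ_apply,
      Submodule.Quotient.mk_eq_zero]
    exact key a b p
  exact (Submodule.Quotient.mk_eq_zero S).1 congr($this f)

end PathAlgebra

/-! ### Vertices of the stretched quiver and multiplicativity of θ* -/

namespace StretchedQuiver

variable {V : Type v} [Quiver.{w} V] {A : ℕ}

/-- The old vertex `a` if the vertex is `a` or lies on an arrow which starts at `a`. -/
def base : StretchedQuiver V A → V
  | old a => a
  | new (a := a) _ _ _ _ => a

theorem node_of_lt {a b : V} (α : a ⟶ b) {i : ℕ} (h0 : 0 < i) (hA : i < A) :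
    node A α i = new α i h0 hA := by
  simp [node, h0.ne', hA]

theorem base_node {a b : V} (α : a ⟶ b) {i : ℕ} (hA : i < A) : base (node A α i) = a := by
  rcases Nat.eq_zero_or_pos i with rfl | h0
  · rfl
  · rw [node_of_lt α h0 hA]
    rfl

theorem old_ne_node {a b c : V} (α : a ⟶ b) {i : ℕ} (h0 : 0 < i) (hA : i < A) :
    old c ≠ node A α i := by
  rw [node_of_lt α h0 hA]
  exact fun h => by cases h

/-- A vertex strictly inside a segment determines the arrow and the position. Only one of the two
positions has to be positive: the other cannot be 0, since it would then give an old vertex. This is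
what makes the outgoing arrow at a new vertex unique. -/
theorem node_injective {a b c d : V} {α : a ⟶ b} {β : c ⟶ d} {i j : ℕ} (h0 : 0 < i) (hi : i < A)
    (hj : j < A) (h : node A α i = node A β j) :
    (⟨a, b, α, i⟩ : Σ a b : V, (_ : a ⟶ b) × ℕ) = ⟨c, d, β, j⟩ := by
  rcases Nat.eq_zero_or_pos j with rfl | hj0
  · exact absurd h.symm (old_ne_node α h0 hi)
  · rw [node_of_lt α h0 hi, node_of_lt β hj0 hj] at h
    cases h
    rfl

/-- The new vertices: the pairs consisting of an arrow and some `0 < i < A`. -/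
abbrev New (V : Type v) [Quiver.{w} V] (A : ℕ) : Type (max v w) :=
  Σ a b : V, (_ : a ⟶ b) × {i : Fin A // 0 < i.1}

theorem bijective_vertices : Function.Bijective
    (Sum.elim old (fun x => node A x.2.2.1 x.2.2.2.1.1) : V ⊕ New V A → StretchedQuiver V A) := by
  constructor
  · rintro (a | ⟨a, b, α, ⟨i, hi⟩, h0⟩) (c | ⟨c, d, β, ⟨j, hj⟩, hj0⟩) h
    · cases h
      rfl
    · exact absurd h (old_ne_node β hj0 hj)
    · exact absurd h.symm (old_ne_node α h0 hi)
    · cases node_injective h0 hi hj h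
      rfl
  · rintro (a | ⟨α, i, h0, hA⟩)
    · exact ⟨Sum.inl a, rfl⟩
    · exact ⟨Sum.inr ⟨_, _, α, ⟨i, hA⟩, h0⟩, node_of_lt α h0 hA⟩

end StretchedQuiver

section Theta

open StretchedQuiver PathAlgebra

variable {K : Type u} {V : Type v} [Field K] [Quiver.{w} V] (A : ℕ) [NeZero A]

variable (K) in
theorem thetaStar_ofPath {a b : V} (p : Quiver.Path a b) :
    thetaStar A (ofPath K p) = ofPath K (stretchPath A p) := by
  ext1 x y
  rcases x with c | _
  · rcases y with d | _
    · change Finsupp.mapDomain (fun p : Quiver.Path c d => stretchPath A p) (ofPath K p c d) = _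
      by_cases h : c ≠ a ∨ d ≠ b
      · rw [ofPath_apply_ne p h, ofPath_apply_ne, Finsupp.mapDomain_zero]
        exact h.imp (fun h h' => h (old.inj h')) (fun h h' => h (old.inj h'))
      · push Not at h
        obtain ⟨rfl, rfl⟩ := h
        rw [ofPath_apply_self, ofPath_apply_self, Finsupp.mapDomain_single]
    · rw [ofPath_apply_ne _ (Or.inr fun h => by cases h)]
      rfl
  · rw [ofPath_apply_ne _ (Or.inl fun h => by cases h)]
    rfl

variable (K V) in
/-- The map `θ*` as a linear map. -/
noncomputable def thetaStarLinear :
    PathAlgebra K V →ₗ[K] PathAlgebra K (StretchedQuiver V A) where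
  toFun := thetaStar A
  map_add' f h := by
    ext1 x y
    rcases x with c | _ <;> rcases y with d | _ <;> try exact (add_zero 0).symm
    exact Finsupp.mapDomain_add
  map_smul' k f := by
    ext1 x y
    rcases x with c | _ <;> rcases y with d | _ <;> try exact (smul_zero k).symm
    exact Finsupp.mapDomain_smul k _

theorem thetaStarLinear_ofPath {a b : V} (p : Quiver.Path a b) :
    thetaStarLinear K V A (ofPath K p) = ofPath K (stretchPath A p) := thetaStar_ofPath K A p

theorem thetaStarLinear_vertex (a : V) :
    thetaStarLinear K V A (vertex K a) = vertex K (old a) := thetaStar_ofPath K A _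

theorem thetaStarLinear_arrow {a b : V} (α : a ⟶ b) :
    thetaStarLinear K V A (ofPath K α.toPath) = ofPath K (arrowPath A α) := by
  rw [thetaStarLinear_ofPath]
  congr 1
  exact Quiver.Path.nil_comp _

variable [Fintype V] [∀ a b : V, Finite (a ⟶ b)]

variable (K V) in
/-- The old vertices and the paths which replace the arrows, as elements of the path algebra of
the stretched quiver. -/
noncomputable def stretchedRealization :
    QuiverRealization V (PathAlgebra K (StretchedQuiver V A)) where
  vert a := vertex K (old a)
  arr α := ofPath K (arrowPath A α)
  vert_mul_self a := vertex_mul_self _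
  vert_mul_of_ne h := ofPath_mul_ofPath_of_ne _ _ fun h' => h (old.inj h')
  vert_mul_arr α := (ofPath_mul_ofPath _ _).trans (by rw [Quiver.Path.nil_comp])
  arr_mul_vert α := ofPath_mul_ofPath _ _

theorem stretchedRealization_path {a b : V} (p : Quiver.Path a b) :
    (stretchedRealization K V A).path p = ofPath K (stretchPath A p) := by
  induction p with
  | nil => rfl
  | cons p α ih =>
    rw [QuiverRealization.path_cons, ih]
    exact ofPath_mul_ofPath _ _

/-- Recognizing θ* as the map attached to a realization yields its multiplicativity for free. -/
theorem thetaStarLinear_eq : thetaStarLinear K V A = liftLinear (stretchedRealization K V A) :=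
  linearMap_ext fun a b p => by
    rw [liftLinear_ofPath, stretchedRealization_path]
    exact thetaStar_ofPath K A p

theorem thetaStarLinear_mul (f h : PathAlgebra K V) :
    thetaStarLinear K V A (f * h) = thetaStarLinear K V A f * thetaStarLinear K V A h := by
  rw [thetaStarLinear_eq, liftLinear_mul]

end Theta

/-! ### Normal forms in the stretched algebra -/

namespace StretchedAlgebra

open StretchedQuiver PathAlgebra

variable {K : Type u} {V : Type v} [Field K] [Quiver.{w} V] {A : ℕ} [NeZero A]
  [Fintype V] [∀ a b : V, Finite (a ⟶ b)] (g : Set (PathAlgebra K V))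

/-- A vertex of the stretched quiver, as an element of the stretched algebra. -/
noncomputable def vert (x : StretchedQuiver V A) : StretchedAlgebra A g :=
  quotMk _ (vertex K x)

/-- The arrow `α_{j+1}`, as an element of the stretched algebra. -/
noncomputable def arr {a b : V} (α : a ⟶ b) (j : ℕ) (hj : j < A) : StretchedAlgebra A g :=
  quotMk _ (ofPath K (seg A α j hj).toPath)

/-- The path `α_1 ⋯ α_i`, as an element of the stretched algebra. -/
noncomputable def init {a b : V} (α : a ⟶ b) (i : ℕ) (hi : i ≤ A) : StretchedAlgebra A g :=
  quotMk _ (ofPath K (initialPath A α i hi))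

variable (A) in
/-- The map `θ*` with values in the stretched algebra. -/
noncomputable def theta : PathAlgebra K V →ₗ[K] StretchedAlgebra A g :=
  (quotMk _).toLinearMap ∘ₗ thetaStarLinear K V A

theorem theta_apply (f : PathAlgebra K V) :
    theta A g f = quotMk _ (thetaStarLinear K V A f) := rfl

theorem theta_mul (f h : PathAlgebra K V) : theta A g (f * h) = theta A g f * theta A g h := by
  rw [theta_apply, thetaStarLinear_mul, map_mul]
  rfl

theorem theta_vertex (a : V) : theta A g (vertex K a) = vert g (old a) := by
  rw [theta_apply, thetaStarLinear_vertex]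
  rfl

theorem theta_eq_zero {f : PathAlgebra K V} (hf : quotMk g f = 0) : theta A g f = 0 := by
  rw [quotMk_eq_zero_iff] at hf
  induction hf using TwoSidedIdeal.span_induction with
  | mem f hf => exact quotMk_eq_zero ⟨f, hf, rfl⟩
  | zero => exact map_zero _
  | add x y _ _ hx hy => rw [map_add, hx, hy, add_zero]
  | neg x _ hx => rw [map_neg, hx, neg_zero]
  | left_absorb a x _ hx => rw [theta_mul, hx, mul_zero]
  | right_absorb a x _ hx => rw [theta_mul, hx, zero_mul]

theorem vert_mul_self (x : StretchedQuiver V A) : vert g x * vert g x = vert g x := by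
  rw [vert, ← map_mul, vertex_mul_self]

theorem vert_mul_of_ne {x y : StretchedQuiver V A} (h : x ≠ y) : vert g x * vert g y = 0 := by
  rw [vert, vert, ← map_mul, vertex_mul_of_ne h, map_zero]

theorem sum_vert : ∑ x : StretchedQuiver V A, vert g x = 1 := by
  rw [← map_one (quotMk (thetaStar A '' g)), one_def, map_sum]
  rfl

theorem stretchedIdempotent_eq : stretchedIdempotent A g = ∑ a : V, vert g (old a) :=
  map_sum (quotMk (thetaStar A '' g)) _ _

theorem idem_mul_old (a : V) :
    stretchedIdempotent A g * vert g (old a) = vert g (old a) := by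
  rw [stretchedIdempotent_eq, Finset.sum_mul, Finset.sum_eq_single a]
  · exact vert_mul_self g _
  · exact fun b _ hb => vert_mul_of_ne g fun h => hb (old.inj h)
  · simp

theorem old_mul_idem (a : V) :
    vert g (old a) * stretchedIdempotent A g = vert g (old a) := by
  rw [stretchedIdempotent_eq, Finset.mul_sum, Finset.sum_eq_single a]
  · exact vert_mul_self g _
  · exact fun b _ hb => vert_mul_of_ne g fun h => hb (old.inj h).symm
  · simp

theorem idem_mul_node {a b : V} (α : a ⟶ b) {i : ℕ} (h0 : 0 < i) (hA : i < A) :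
    stretchedIdempotent A g * vert g (node A α i) = 0 := by
  rw [stretchedIdempotent_eq, Finset.sum_mul]
  exact Finset.sum_eq_zero fun c _ => vert_mul_of_ne g (old_ne_node α h0 hA)

theorem node_mul_idem {a b : V} (α : a ⟶ b) {i : ℕ} (h0 : 0 < i) (hA : i < A) :
    vert g (node A α i) * stretchedIdempotent A g = 0 := by
  rw [stretchedIdempotent_eq, Finset.mul_sum]
  exact Finset.sum_eq_zero fun c _ => vert_mul_of_ne g (old_ne_node α h0 hA).symm

variable (A) in
theorem theta_one : theta A g 1 = stretchedIdempotent A g := by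
  rw [one_def, map_sum, stretchedIdempotent_eq]
  exact Finset.sum_congr rfl fun a _ => theta_vertex g a

theorem idem_mul_theta (f : PathAlgebra K V) :
    stretchedIdempotent A g * theta A g f = theta A g f := by
  rw [← theta_one, ← theta_mul, one_mul]

theorem theta_mul_idem (f : PathAlgebra K V) :
    theta A g f * stretchedIdempotent A g = theta A g f := by
  rw [← theta_one, ← theta_mul, mul_one]

section Paths

variable {a b : V} (α : a ⟶ b)

theorem vert_mul_arr (j : ℕ) (hj : j < A) : vert g (node A α j) * arr g α j hj = arr g α j hj := by
  rw [vert, arr, ← map_mul]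
  congr 1
  exact (realization K (StretchedQuiver V A)).vert_mul_arr (seg A α j hj)

theorem arr_mul_vert (j : ℕ) (hj : j < A) :
    arr g α j hj * vert g (node A α (j + 1)) = arr g α j hj := by
  rw [vert, arr, ← map_mul]
  congr 1
  exact (realization K (StretchedQuiver V A)).arr_mul_vert (seg A α j hj)

theorem init_zero : init g α 0 (Nat.zero_le A) = vert g (old a) := rfl

theorem init_succ (i : ℕ) (hi : i < A) :
    init g α (i + 1) hi = init g α i hi.le * arr g α i hi := by
  rw [init, arr, init, ← map_mul, ofPath_mul_ofPath]
  rfl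

theorem init_last : init g α A le_rfl = theta A g (ofPath K α.toPath) := by
  rw [theta_apply, thetaStarLinear_arrow, init, ← realization_path, ← realization_path, arrowPath,
    QuiverRealization.path_cast]

theorem old_mul_init (i : ℕ) (hi : i ≤ A) : vert g (old a) * init g α i hi = init g α i hi := by
  rw [vert, init, ← map_mul, vertex, ofPath_mul_ofPath, Quiver.Path.nil_comp]

theorem init_mul_node (i : ℕ) (hi : i ≤ A) :
    init g α i hi * vert g (node A α i) = init g α i hi := by
  rw [vert, init, ← map_mul, vertex, ofPath_mul_ofPath, Quiver.Path.comp_nil]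

end Paths

theorem exists_arr {x y : StretchedQuiver V A} (c : x ⟶ y) :
    ∃ (a b : V) (α : a ⟶ b) (j : ℕ) (hj : j < A),
      (quotMk (thetaStar A '' g) (ofPath K c.toPath) : StretchedAlgebra A g) = arr g α j hj := by
  obtain ⟨α, ⟨j, hj⟩, hx, hy⟩ := c
  subst hx hy
  exact ⟨_, _, α, j, hj, rfl⟩

theorem eq_top_of_mul_arr_mem (S : Submodule K (StretchedAlgebra A g))
    (hv : ∀ x, vert g x ∈ S)
    (ha : ∀ (a b : V) (α : a ⟶ b) (j : ℕ) (hj : j < A), ∀ s ∈ S, s * arr g α j hj ∈ S)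
    (r : StretchedAlgebra A g) : r ∈ S :=
  quot_eq_top_of_mul_arrow_mem _ S hv (fun x y c s hs => by
    obtain ⟨a, b, α, j, hj, h⟩ := exists_arr g c
    rw [h]
    exact ha a b α j hj s hs) r

theorem vert_mul_arr_of_ne {x : StretchedQuiver V A} {a b : V} (α : a ⟶ b) {j : ℕ} (hj : j < A)
    (h : x ≠ node A α j) : vert g x * arr g α j hj = 0 := by
  rw [← vert_mul_arr, ← mul_assoc, vert_mul_of_ne g h, zero_mul]

/-- Multiplication by the vertex `w_i` of an arrow takes the algebra to the sum of the line spanned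
by `w_i` and the right ideal generated by the arrow that starts at `w_i`. -/
theorem node_mul_mem {a b : V} (α : a ⟶ b) {i : ℕ} (h0 : 0 < i) (hA : i < A)
    (r : StretchedAlgebra A g) : ∃ (k : K) (s : StretchedAlgebra A g),
      vert g (node A α i) * r = k • vert g (node A α i) + arr g α i hA * s := by
  let S : Submodule K (StretchedAlgebra A g) :=
    { carrier := {r | ∃ (k : K) (s : StretchedAlgebra A g),
        vert g (node A α i) * r = k • vert g (node A α i) + arr g α i hA * s}
      add_mem' := by
        rintro r r' ⟨k, s, h⟩ ⟨k', s', h'⟩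
        exact ⟨k + k', s + s', by rw [mul_add, h, h', add_smul, mul_add]; abel⟩
      zero_mem' := ⟨0, 0, by simp⟩
      smul_mem' := by
        rintro l r ⟨k, s, h⟩
        exact ⟨l * k, l • s, by rw [mul_smul_comm, h, smul_add, mul_smul, mul_smul_comm]⟩ }
  refine eq_top_of_mul_arr_mem g S (fun x => ?_) (fun c d β j hj r hr => ?_) r
  · by_cases hx : x = node A α i
    · subst hx
      exact ⟨1, 0, by rw [vert_mul_self, one_smul, mul_zero, add_zero]⟩
    · exact ⟨0, 0, by rw [vert_mul_of_ne g (Ne.symm hx), zero_smul, mul_zero, add_zero]⟩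
  · obtain ⟨k, s, h⟩ := hr
    by_cases hx : node A α i = node A β j
    · cases node_injective h0 hA hj hx
      -- The only arrow leaving w_i turns the scalar part k w_i into k α_{i+1}, which is absorbed
      -- into the second summand.
      exact ⟨0, k • 1 + s * arr g α i hj, by
        rw [← mul_assoc, h, add_mul, smul_mul_assoc, vert_mul_arr, zero_smul, zero_add, mul_add,
          mul_smul_comm, mul_one, mul_assoc]⟩
    · exact ⟨0, s * arr g β j hj, by
        rw [← mul_assoc, h, add_mul, smul_mul_assoc, vert_mul_arr_of_ne g β hj hx, smul_zero,
          zero_add, zero_smul, zero_add, mul_assoc]⟩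

/-- The elements `θ*(f)` and `θ*(f) α_1 ⋯ α_i`. -/
def thetaInit : Set (StretchedAlgebra A g) :=
  {r | (∃ f, r = theta A g f) ∨ ∃ (f : PathAlgebra K V) (a b : V) (α : a ⟶ b) (i : ℕ) (_ : 0 < i)
    (hA : i < A), r = theta A g f * init g α i hA.le}

theorem theta_mul_init_mem (f : PathAlgebra K V) {a b : V} (α : a ⟶ b) (i : ℕ) (hi : i ≤ A) :
    theta A g f * init g α i hi ∈ thetaInit g := by
  rcases Nat.eq_zero_or_pos i with rfl | h0
  -- The empty initial segment is the vertex a, and below the full one is θ*(α), so both extreme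
  -- cases are again values of θ*.
  · exact Or.inl ⟨f * vertex K a, by rw [theta_mul, theta_vertex, init_zero]⟩
  · rcases hi.lt_or_eq with hA | rfl
    · exact Or.inr ⟨f, a, b, α, i, h0, hA, rfl⟩
    · exact Or.inl ⟨f * ofPath K α.toPath, by rw [theta_mul, init_last]⟩

/-- A path that starts at an old vertex runs through whole segments and then possibly through an
initial part of one more. Formally, the span of such elements is stable under right multiplication
by arrows. -/
theorem idem_mul_mem (r : StretchedAlgebra A g) :
    stretchedIdempotent A g * r ∈ Submodule.span K (thetaInit g) := by
  refine eq_top_of_mul_arr_mem g ((Submodule.span K (thetaInit g)).comap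
    (LinearMap.mulLeft K (stretchedIdempotent A g))) (fun x => ?_) (fun c d β j hj r hr => ?_) r
  · obtain ⟨x | ⟨a, b, α, ⟨i, hA⟩, h0⟩, rfl⟩ := bijective_vertices.2 x
    · refine Submodule.subset_span (Or.inl ⟨vertex K x, ?_⟩)
      rw [LinearMap.mulLeft_apply, Sum.elim_inl, theta_vertex, idem_mul_old]
    · rw [Submodule.mem_comap, LinearMap.mulLeft_apply, Sum.elim_inr]
      rw [idem_mul_node g α h0 hA]
      exact Submodule.zero_mem _
  · rw [Submodule.mem_comap, LinearMap.mulLeft_apply] at hr ⊢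
    rw [← mul_assoc]
    generalize stretchedIdempotent A g * r = s at hr
    induction hr using Submodule.span_induction with
    | zero => rw [zero_mul]; exact Submodule.zero_mem _
    | add x y _ _ hx hy => rw [add_mul]; exact Submodule.add_mem _ hx hy
    | smul k x _ hx => rw [smul_mul_assoc]; exact Submodule.smul_mem _ _ hx
    | mem x hx =>
      rcases hx with ⟨f, rfl⟩ | ⟨f, a, b, α, i, h0, hA, rfl⟩
      -- After complete segments the path is at an old vertex: only a first arrow of a segment can
      -- follow, any other arrow gives 0.
      · rcases Nat.eq_zero_or_pos j with rfl | h0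
        · rw [← vert_mul_arr]
          refine Submodule.subset_span ?_
          have := theta_mul_init_mem g f β 1 hj
          rwa [init_succ g β 0 hj] at this
        · rw [← theta_mul_idem, mul_assoc, ← vert_mul_arr, ← mul_assoc (stretchedIdempotent A g),
            idem_mul_node g β h0 hj, zero_mul, mul_zero]
          exact Submodule.zero_mem _
      · by_cases hx : node A α i = node A β j
        · cases node_injective h0 hA hj hx
          rw [mul_assoc, ← init_succ]
          exact Submodule.subset_span (theta_mul_init_mem g f β (j + 1) hj)
        · rw [← init_mul_node, mul_assoc, mul_assoc, vert_mul_arr_of_ne g β hj hx, mul_zero,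
            mul_zero]
          exact Submodule.zero_mem _

/-- Of the normal forms, those ending strictly inside a segment are killed by ε on the right. This
gives surjectivity onto the corner. -/
theorem exists_theta_eq (r : StretchedAlgebra A g) :
    ∃ f, stretchedIdempotent A g * r * stretchedIdempotent A g = theta A g f := by
  have := idem_mul_mem g r
  generalize stretchedIdempotent A g * r = s at this
  induction this using Submodule.span_induction with
  | zero => exact ⟨0, by simp⟩
  | add x y _ _ hx hy =>
    obtain ⟨f, hf⟩ := hx
    obtain ⟨h, hh⟩ := hy
    exact ⟨f + h, by rw [add_mul, hf, hh, map_add]⟩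
  | smul k x _ hx =>
    obtain ⟨f, hf⟩ := hx
    exact ⟨k • f, by rw [smul_mul_assoc, hf, map_smul]⟩
  | mem x hx =>
    rcases hx with ⟨f, rfl⟩ | ⟨f, a, b, α, i, h0, hA, rfl⟩
    · exact ⟨f, theta_mul_idem g f⟩
    · exact ⟨0, by rw [← init_mul_node, mul_assoc, mul_assoc, node_mul_idem g α h0 hA, mul_zero,
        mul_zero, map_zero]⟩

/-- Right multiplication by w_i selects, among the normal forms, those that end at this vertex. -/
theorem exists_theta_mul_init_eq {a b : V} (α : a ⟶ b) {i : ℕ} (h0 : 0 < i) (hA : i < A)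
    (r : StretchedAlgebra A g) : ∃ f,
      stretchedIdempotent A g * r * vert g (node A α i) = theta A g f * init g α i hA.le := by
  have := idem_mul_mem g r
  generalize stretchedIdempotent A g * r = s at this
  induction this using Submodule.span_induction with
  | zero => exact ⟨0, by simp⟩
  | add x y _ _ hx hy =>
    obtain ⟨f, hf⟩ := hx
    obtain ⟨h, hh⟩ := hy
    exact ⟨f + h, by rw [add_mul, hf, hh, map_add, add_mul]⟩
  | smul k x _ hx =>
    obtain ⟨f, hf⟩ := hx
    exact ⟨k • f, by rw [smul_mul_assoc, hf, map_smul, smul_mul_assoc]⟩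
  | mem x hx =>
    rcases hx with ⟨f, rfl⟩ | ⟨f, c, d, β, j, hj0, hj, rfl⟩
    · exact ⟨0, by rw [← theta_mul_idem, mul_assoc, idem_mul_node g α h0 hA, mul_zero, map_zero,
        zero_mul]⟩
    · by_cases hx : node A α i = node A β j
      · cases node_injective h0 hA hj hx
        exact ⟨f, by rw [mul_assoc, init_mul_node]⟩
      · exact ⟨0, by rw [← init_mul_node, mul_assoc, mul_assoc, vert_mul_of_ne g (Ne.symm hx),
          mul_zero, mul_zero, map_zero, zero_mul]⟩

end StretchedAlgebra

/-! ### Cancellation via matrix representations, and the corner algebra -/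

namespace StretchedAlgebra

open StretchedQuiver PathAlgebra

variable {K : Type u} {V : Type v} [Field K] [Quiver.{w} V] {A : ℕ} [NeZero A]
  [Fintype V] (g : Set (PathAlgebra K V))

theorem quotMk_eq_zero_of_vertex_mul (f : PathAlgebra K V)
    (h : ∀ a, quotMk g (vertex K a * f) = 0) : quotMk g f = 0 := by
  rw [← one_mul f, one_def, Finset.sum_mul, map_sum]
  exact Finset.sum_eq_zero fun a _ => h a

variable [∀ a b : V, Finite (a ⟶ b)]

section Matrices

open Classical in
variable (A) in
/-- The realization of the stretched quiver by matrices over the given algebra in which the last of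
the arrows replacing `α` becomes `α` and the others become vertices. -/
noncomputable def matrixRealization : QuiverRealization (StretchedQuiver V A)
    (Matrix (StretchedQuiver V A) (StretchedQuiver V A) (PathAlgebra.Quot g)) where
  vert x := Matrix.single x x (quotMk g (vertex K x.base))
  arr {x y} c := Matrix.single x y (quotMk g
    (if c.idx.1 + 1 < A then vertex K c.src else ofPath K c.arrow.toPath))
  vert_mul_self x := by
    rw [Matrix.single_mul_single_same, ← map_mul, vertex_mul_self]
  vert_mul_of_ne h := Matrix.single_mul_single_of_ne _ _ _ _ h _
  vert_mul_arr {x y} c := by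
    obtain ⟨α, ⟨j, hj⟩, rfl, rfl⟩ := c
    rw [Matrix.single_mul_single_same, ← map_mul, base_node α hj]
    congr 2
    split_ifs
    · exact vertex_mul_self _
    · exact (realization K V).vert_mul_arr α
  arr_mul_vert {x y} c := by
    obtain @⟨a, b, α, ⟨j, hj⟩, rfl, rfl⟩ := c
    rw [Matrix.single_mul_single_same, ← map_mul]
    congr 2
    split_ifs with h
    · rw [base_node α h]
      exact vertex_mul_self _
    · have hj' : j + 1 = A := by simp only at h; omega
      have hb : node A α (j + 1) = old b := by rw [hj', node_last]
      change ofPath K α.toPath * vertex K (node A α (j + 1)).base = ofPath K α.toPath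
      rw [hb]
      exact (realization K V).arr_mul_vert α

open Classical in
theorem matrixRealization_vert (x : StretchedQuiver V A) :
    (matrixRealization A g).vert x = Matrix.single x x (quotMk g (vertex K x.base)) := rfl

open Classical in
theorem matrixRealization_arr {x y : StretchedQuiver V A} (c : x ⟶ y) :
    (matrixRealization A g).arr c = Matrix.single x y (quotMk g
      (if c.idx.1 + 1 < A then vertex K c.src else ofPath K c.arrow.toPath)) := rfl

open Classical in
theorem matrixRealization_initialPath {a b : V} (α : a ⟶ b) (i : ℕ) (hi : i ≤ A) :
    (matrixRealization A g).path (initialPath A α i hi) =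
      Matrix.single (old a) (node A α i)
        (quotMk g (if i < A then vertex K a else ofPath K α.toPath)) := by
  induction i with
  | zero =>
    rw [if_pos (Nat.pos_of_neZero A)]
    exact matrixRealization_vert g (old a)
  | succ i ih =>
    change (matrixRealization A g).path (initialPath A α i (Nat.le_of_succ_le hi)) *
      (matrixRealization A g).arr (seg A α i hi) = _
    rw [ih, if_pos (Nat.lt_of_succ_le hi)]
    rw [matrixRealization_arr, Matrix.single_mul_single_same, ← map_mul]
    congr 2
    change vertex K a * (if i + 1 < A then vertex K a else ofPath K α.toPath) = _
    split_ifs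
    · exact vertex_mul_self _
    · exact (realization K V).vert_mul_arr α

open Classical in
theorem matrixRealization_arrowPath {a b : V} (α : a ⟶ b) :
    (matrixRealization A g).path (arrowPath A α) =
      Matrix.single (old a) (old b) (quotMk g (ofPath K α.toPath)) := by
  rw [arrowPath, QuiverRealization.path_cast, matrixRealization_initialPath,
    if_neg (lt_irrefl A), node_last]

open Classical in
theorem matrixRealization_stretchPath {a b : V} (p : Quiver.Path a b) :
    (matrixRealization A g).path (stretchPath A p) =
      Matrix.single (old a) (old b) (quotMk g (ofPath K p)) := by
  induction p with
  | nil => exact matrixRealization_vert g _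
  | cons p α ih =>
    change (matrixRealization A g).path ((stretchPath A p).comp (arrowPath A α)) = _
    rw [QuiverRealization.path_comp, ih, matrixRealization_arrowPath,
      Matrix.single_mul_single_same, ← map_mul, ofPath_mul_ofPath]
    rfl

open Classical in
-- The matrix of a stretched path has the original path as its only nonzero entry at most, because
-- the arrows before the last become vertices. So the entries at old vertices recover f modulo the
-- ideal, which later proves θ injective.
theorem liftLinear_matrixRealization_thetaStar (f : PathAlgebra K V) (a b : V) :
    liftLinear (matrixRealization A g) (thetaStarLinear K V A f) (old a) (old b) =
      quotMk g (vertex K a * f * vertex K b) := by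
  have : Matrix.entryLinearMap K (PathAlgebra.Quot g) (old a) (old b) ∘ₗ
      liftLinear (matrixRealization A g) ∘ₗ thetaStarLinear K V A =
      (quotMk g).toLinearMap ∘ₗ LinearMap.mulRight K (vertex K b) ∘ₗ
        LinearMap.mulLeft K (vertex K a) := by
    refine linearMap_ext fun c d p => ?_
    simp only [LinearMap.comp_apply, LinearMap.mulLeft_apply, LinearMap.mulRight_apply,
      thetaStarLinear_ofPath, liftLinear_ofPath, matrixRealization_stretchPath,
      Matrix.entryLinearMap_apply, AlgHom.toLinearMap_apply]
    by_cases hc : a = c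
    · subst hc
      rw [vertex, ofPath_mul_ofPath, Quiver.Path.nil_comp]
      by_cases hd : d = b
      · subst hd
        rw [vertex, ofPath_mul_ofPath, Quiver.Path.comp_nil, Matrix.single_apply_same]
      · rw [vertex, ofPath_mul_ofPath_of_ne _ _ hd, map_zero, Matrix.single_apply_of_ne]
        exact fun h => hd (old.inj h.2)
    · rw [vertex, ofPath_mul_ofPath_of_ne _ _ hc, zero_mul, map_zero, Matrix.single_apply_of_ne]
      exact fun h => hc (old.inj h.1).symm
  exact congr($this f)

open Classical in
theorem liftLinear_matrixRealization_thetaStar_of_ne (f : PathAlgebra K V)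
    {x y : StretchedQuiver V A} (h : ∀ a b, ¬ (old a = x ∧ old b = y)) :
    liftLinear (matrixRealization A g) (thetaStarLinear K V A f) x y = 0 := by
  have : Matrix.entryLinearMap K (PathAlgebra.Quot g) x y ∘ₗ
      liftLinear (matrixRealization A g) ∘ₗ thetaStarLinear K V A = 0 := by
    refine linearMap_ext fun c d p => ?_
    simp only [LinearMap.comp_apply, thetaStarLinear_ofPath, liftLinear_ofPath,
      matrixRealization_stretchPath, Matrix.entryLinearMap_apply, LinearMap.zero_apply]
    exact Matrix.single_apply_of_ne _ _ _ _ _ (h c d)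
  exact congr($this f)

open Classical in
-- The representation factors through the stretched algebra: the entries of a relation θ*(f) are
-- classes of a f b, with f already zero in the given algebra.
theorem liftLinear_matrixRealization_eq_zero {f : PathAlgebra K (StretchedQuiver V A)}
    (hf : (quotMk (thetaStar A '' g) f) = 0) : liftLinear (matrixRealization A g) f = 0 := by
  refine liftLinear_eq_zero _ ?_ ((quotMk_eq_zero_iff _).1 hf)
  rintro _ ⟨f, hf, rfl⟩
  ext x y
  by_cases h : ∃ a b, old a = x ∧ old b = y
  · obtain ⟨a, b, rfl, rfl⟩ := h
    refine (liftLinear_matrixRealization_thetaStar g f a b).trans ?_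
    rw [map_mul, map_mul, quotMk_eq_zero hf, mul_zero, zero_mul, Matrix.zero_apply]
  · exact liftLinear_matrixRealization_thetaStar_of_ne g f fun a b hab => h ⟨a, b, hab⟩

/-- A proper initial segment is represented by a matrix unit carrying just the vertex a, since α
itself appears only at the last arrow. The entries in column w_i therefore show c f a = 0 for all c.
-/
theorem theta_mul_init_eq_zero {f : PathAlgebra K V} {a b : V} (α : a ⟶ b) {i : ℕ} (hA : i < A)
    (h : theta A g f * init g α i hA.le = 0) : theta A g f * vert g (old a) = 0 := by
  classical
  rw [theta_apply, init, ← map_mul] at h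
  have h := liftLinear_matrixRealization_eq_zero g h
  rw [← theta_vertex, ← theta_mul]
  refine theta_eq_zero g (quotMk_eq_zero_of_vertex_mul g _ fun c => ?_)
  have hc := congrFun (congrFun h (old c)) (node A α i)
  rw [liftLinear_mul, liftLinear_ofPath, matrixRealization_initialPath, if_pos hA,
    Matrix.mul_single_apply_same, liftLinear_matrixRealization_thetaStar, ← map_mul, mul_assoc,
    vertex_mul_self, mul_assoc] at hc
  exact hc

theorem quotMk_eq_zero_of_theta_eq_zero {f : PathAlgebra K V} (h : theta A g f = 0) :
    quotMk g f = 0 := by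
  refine quotMk_eq_zero_of_vertex_mul g _ fun a => ?_
  rw [← mul_one (_ * f), one_def, Finset.mul_sum, map_sum]
  refine Finset.sum_eq_zero fun b _ => ?_
  rw [← liftLinear_matrixRealization_thetaStar (A := A), liftLinear_matrixRealization_eq_zero g h]
  rfl

end Matrices

section Derivative

open Classical in
/-- The realization of the stretched quiver by triangular matrices `(σ(u), ∂(u); 0, u)`, where
`σ(u)` is the coefficient of `u` at the vertex `z` and `∂` is left division by the arrows which
start at `z`. -/
noncomputable def derivRealization (z : StretchedQuiver V A) :
    QuiverRealization (StretchedQuiver V A) (Matrix (Fin 2) (Fin 2) (StretchedAlgebra A g)) where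
  vert x := !![if x = z then 1 else 0, 0; 0, vert g x]
  arr {x y} c := !![0, if x = z then vert g y else 0; 0, quotMk _ (ofPath K c.toPath)]
  vert_mul_self x := by
    rw [Matrix.mul_fin_two]
    by_cases h : x = z <;> simp [vert_mul_self, h]
  vert_mul_of_ne {x y} h := by
    have : (if x = z then (1 : StretchedAlgebra A g) else 0) * (if y = z then 1 else 0) = 0 := by
      split_ifs with hx hy
      · exact absurd (hx.trans hy.symm) h
      · rw [mul_zero]
      · rw [zero_mul]
      · rw [zero_mul]
    rw [Matrix.mul_fin_two, this, vert_mul_of_ne g h]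
    ext i j
    fin_cases i <;> fin_cases j <;> simp
  vert_mul_arr {x y} c := by
    have : vert g x * quotMk (thetaStar A '' g) (ofPath K c.toPath) =
        quotMk _ (ofPath K c.toPath) := by
      rw [vert, ← map_mul]
      congr 1
      exact (realization K (StretchedQuiver V A)).vert_mul_arr c
    rw [Matrix.mul_fin_two, this]
    by_cases h : x = z <;> simp [h]
  arr_mul_vert {x y} c := by
    have : quotMk (thetaStar A '' g) (ofPath K c.toPath) * vert g y =
        quotMk _ (ofPath K c.toPath) := by
      rw [vert, ← map_mul]
      congr 1
      exact (realization K (StretchedQuiver V A)).arr_mul_vert c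
    rw [Matrix.mul_fin_two, this]
    ext i j
    fin_cases i <;> fin_cases j <;> simp [vert_mul_self]

theorem derivRealization_path (z : StretchedQuiver V A) {x y : StretchedQuiver V A}
    (p : Quiver.Path x y) : (derivRealization g z).path p 1 0 = 0 ∧
      (derivRealization g z).path p 1 1 = quotMk _ (ofPath K p) := by
  induction p with
  | nil => exact ⟨rfl, rfl⟩
  | cons p c ih =>
    rw [QuiverRealization.path_cons, Matrix.mul_apply, Matrix.mul_apply, Fin.sum_univ_two,
      Fin.sum_univ_two, ih.1, ih.2]
    constructor
    · change 0 * _ + _ * 0 = 0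
      rw [zero_mul, mul_zero, add_zero]
    · change 0 * _ + _ * quotMk _ (ofPath K c.toPath) = _
      rw [zero_mul, zero_add, ← map_mul, ofPath_mul_ofPath]
      rfl

theorem derivRealization_path_of_ne {x y z : StretchedQuiver V A} (h : x ≠ z)
    (p : Quiver.Path x y) (j : Fin 2) : (derivRealization g z).path p 0 j = 0 := by
  rw [← QuiverRealization.vert_mul_path, Matrix.mul_apply, Fin.sum_univ_two]
  have h0 : (derivRealization g z).vert x 0 0 = 0 := if_neg h
  have h1 : (derivRealization g z).vert x 0 1 = 0 := rfl
  rw [h0, h1, zero_mul, zero_mul, add_zero]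

theorem liftLinear_derivRealization_one_zero (z : StretchedQuiver V A)
    (f : PathAlgebra K (StretchedQuiver V A)) :
    liftLinear (derivRealization g z) f 1 0 = 0 := by
  have : Matrix.entryLinearMap K (StretchedAlgebra A g) 1 0 ∘ₗ
      liftLinear (derivRealization g z) = 0 := linearMap_ext fun a b p => by
    rw [LinearMap.comp_apply, liftLinear_ofPath, Matrix.entryLinearMap_apply]
    exact (derivRealization_path g z p).1
  exact congr($this f)

theorem liftLinear_derivRealization_one_one (z : StretchedQuiver V A)
    (f : PathAlgebra K (StretchedQuiver V A)) :
    liftLinear (derivRealization g z) f 1 1 = quotMk _ f := by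
  have : Matrix.entryLinearMap K (StretchedAlgebra A g) 1 1 ∘ₗ
      liftLinear (derivRealization g z) = (quotMk _).toLinearMap := linearMap_ext fun a b p => by
    rw [LinearMap.comp_apply, liftLinear_ofPath, Matrix.entryLinearMap_apply]
    exact (derivRealization_path g z p).2
  exact congr($this f)

/-- Stretched paths start at old vertices, so neither the coefficient at a new vertex z nor left
division by an arrow from z sees them. This makes the triangular representation respect the
relations. -/
theorem liftLinear_derivRealization_thetaStar {z : StretchedQuiver V A} (hz : ∀ a, old a ≠ z)
    (f : PathAlgebra K V) (j : Fin 2) :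
    liftLinear (derivRealization g z) (thetaStarLinear K V A f) 0 j = 0 := by
  have : Matrix.entryLinearMap K (StretchedAlgebra A g) 0 j ∘ₗ
      liftLinear (derivRealization g z) ∘ₗ thetaStarLinear K V A = 0 :=
    linearMap_ext fun a b p => by
      rw [LinearMap.comp_apply, LinearMap.comp_apply, thetaStarLinear_ofPath, liftLinear_ofPath,
        Matrix.entryLinearMap_apply]
      exact derivRealization_path_of_ne g (hz a) _ j
  exact congr($this f)

theorem liftLinear_derivRealization_eq_zero {z : StretchedQuiver V A} (hz : ∀ a, old a ≠ z)
    {f : PathAlgebra K (StretchedQuiver V A)} (hf : quotMk (thetaStar A '' g) f = 0) :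
    liftLinear (derivRealization g z) f = 0 := by
  refine liftLinear_eq_zero _ ?_ ((quotMk_eq_zero_iff _).1 hf)
  rintro _ ⟨f, hf, rfl⟩
  ext i j
  fin_cases i
  · exact liftLinear_derivRealization_thetaStar g hz f j
  · fin_cases j
    · exact liftLinear_derivRealization_one_zero g z _
    · exact (liftLinear_derivRealization_one_one g z _).trans (quotMk_eq_zero ⟨f, hf, rfl⟩)

/-- Left division by the arrows starting at w_i is well defined on the stretched algebra, and
dividing α_{i+1} r recovers r multiplied by the end of the arrow; this is the upper right entry of
the triangular matrix. -/
theorem vert_mul_eq_zero_of_arr_mul_eq_zero {a b : V} (α : a ⟶ b) {i : ℕ} (h0 : 0 < i)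
    (hA : i < A) {r : StretchedAlgebra A g} (h : arr g α i hA * r = 0) :
    vert g (node A α (i + 1)) * r = 0 := by
  obtain ⟨f, rfl⟩ := quotMk_surjective _ r
  rw [arr, ← map_mul] at h
  have h := congrFun (congrFun (liftLinear_derivRealization_eq_zero g
    (fun c => old_ne_node α h0 hA) h) 0) 1
  rw [liftLinear_mul, Matrix.mul_apply, Fin.sum_univ_two, liftLinear_ofPath,
    liftLinear_derivRealization_one_one] at h
  have h1 : (derivRealization g (node A α i)).path (seg A α i hA).toPath =
      (derivRealization g (node A α i)).arr (seg A α i hA) :=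
    (derivRealization g (node A α i)).vert_mul_arr (seg A α i hA)
  have h2 : (derivRealization g (node A α i)).arr (seg A α i hA) 0 0 = 0 := rfl
  have h3 : (derivRealization g (node A α i)).arr (seg A α i hA) 0 1 =
      vert g (node A α (i + 1)) := if_pos rfl
  rw [h1, h2, h3, zero_mul, zero_add] at h
  exact h

end Derivative

section Corner

open IsIdempotentElem

variable (A) in
/-- The isomorphism from the given algebra to the corner of the stretched algebra. -/
noncomputable def cornerHom :
    PathAlgebra K V →ₐ[K] (stretchedIdempotent_isIdempotentElem A g).Corner :=
  AlgHom.ofLinearMap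
    { toFun := fun f => ⟨theta A g f, (Subsemigroup.mem_corner_iff
        (stretchedIdempotent_isIdempotentElem A g)).2 ⟨idem_mul_theta g f, theta_mul_idem g f⟩⟩
      map_add' := fun f h => Subtype.ext (map_add _ f h)
      map_smul' := fun k f => Subtype.ext (map_smul _ k f) }
    (Subtype.ext (theta_one A g)) fun f h => Subtype.ext (theta_mul g f h)

variable (A) in
/-- The isomorphism from the given algebra to the corner of the stretched algebra. -/
noncomputable def cornerEquiv :
    PathAlgebra.Quot g ≃ₐ[K] (stretchedIdempotent_isIdempotentElem A g).Corner :=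
  AlgEquiv.ofBijective
    (quotLift g (cornerHom A g) fun _ hf =>
      Subtype.ext (theta_eq_zero g (quotMk_eq_zero hf))) (by
    constructor
    · rw [injective_iff_map_eq_zero]
      intro x hx
      obtain ⟨f, rfl⟩ := quotMk_surjective g x
      exact quotMk_eq_zero_of_theta_eq_zero g congr(($hx).1)
    · rintro x
      obtain ⟨f, hf⟩ := exists_theta_eq g x.1
      refine ⟨quotMk g f, Subtype.ext (hf.symm.trans ?_)⟩
      rw [Corner.idem_mul, Corner.mul_idem])

end Corner

end StretchedAlgebra

/-! ### The axioms on the new vertices, and their verification for the stretched algebra -/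

/-- Data on an idempotent `e` of an algebra `R` which express that `R` arises from `eRe` by adding
vertices `f w` that lie on linearly ordered segments: there is exactly one arrow `a w` which starts
at `f w`, it ends at `h w`, and there is exactly one path `i w` from `eRe`, starting at `c w`, which
ends at `f w`. -/
structure SegmentData (K : Type*) [Field K] {R : Type*} [Ring R] [Algebra K R] (e : R)
    (ι : Type*) [Fintype ι] where
  (f a h c i : ι → R)
  rank : ι → ℕ
  f_mul_self : ∀ w, f w * f w = f w
  f_mul_of_ne : ∀ {w w'}, w ≠ w' → f w * f w' = 0
  add_sum : e + ∑ w, f w = 1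
  e_mul_f : ∀ w, e * f w = 0
  f_mul_e : ∀ w, f w * e = 0
  f_mul_a : ∀ w, f w * a w = a w
  a_mul_h : ∀ w, a w * h w = a w
  h_spec : ∀ w, (∃ w', h w = f w' ∧ rank w < rank w') ∨
    (h w * h w = h w ∧ e * h w = h w ∧ h w * e = h w)
  h_mul_eq_zero : ∀ {w r}, a w * r = 0 → h w * r = 0
  exists_f_mul : ∀ w r, ∃ (k : K) (s : R), f w * r = k • f w + a w * s
  c_mul_e : ∀ w, c w * e = c w
  c_mul_self : ∀ w, c w * c w = c w
  c_mul_i : ∀ w, c w * i w = i w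
  i_mul_f : ∀ w, i w * f w = i w
  mul_c_eq_zero : ∀ {w r}, r * i w = 0 → e * r * c w = 0
  exists_mul_f : ∀ w r, ∃ s, e * s = s ∧ s * c w = s ∧ e * r * f w = s * i w

namespace StretchedAlgebra

open StretchedQuiver PathAlgebra

variable {K : Type u} {V : Type v} [Field K] [Quiver.{w} V] {A : ℕ} [NeZero A]
  [Fintype V] [∀ a b : V, Finite (a ⟶ b)] (g : Set (PathAlgebra K V))

noncomputable instance : Fintype (New V A) := Fintype.ofFinite _

theorem idem_add_sum_node : stretchedIdempotent A g +
    ∑ x : New V A, vert g (node A x.2.2.1 x.2.2.2.1.1) = 1 := by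
  rw [← sum_vert, ← bijective_vertices.sum_comp, Fintype.sum_sum_type, stretchedIdempotent_eq]
  rfl

theorem idem_mul_init {a b : V} (α : a ⟶ b) (i : ℕ) (hi : i ≤ A) :
    stretchedIdempotent A g * init g α i hi = init g α i hi := by
  rw [← old_mul_init, ← mul_assoc, idem_mul_old]

variable (A) in
/-- The new vertices of the stretched algebra. -/
noncomputable def segmentData : SegmentData K (stretchedIdempotent A g) (New V A) where
  f x := vert g (node A x.2.2.1 x.2.2.2.1.1)
  a x := arr g x.2.2.1 x.2.2.2.1.1 x.2.2.2.1.2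
  h x := vert g (node A x.2.2.1 (x.2.2.2.1.1 + 1))
  c x := vert g (old x.1)
  i x := init g x.2.2.1 x.2.2.2.1.1 x.2.2.2.1.2.le
  rank x := x.2.2.2.1.1
  f_mul_self x := vert_mul_self g _
  f_mul_of_ne {x y} h := vert_mul_of_ne g fun h' =>
    h (Sum.inr_injective (bijective_vertices.1 (a₁ := Sum.inr x) (a₂ := Sum.inr y) h'))
  add_sum := idem_add_sum_node g
  e_mul_f x := idem_mul_node g _ x.2.2.2.2 x.2.2.2.1.2
  f_mul_e x := node_mul_idem g _ x.2.2.2.2 x.2.2.2.1.2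
  f_mul_a x := vert_mul_arr g _ _ _
  a_mul_h x := arr_mul_vert g _ _ _
  h_spec x := by
    obtain ⟨a, b, α, ⟨i, hi⟩, h0⟩ := x
    by_cases h : i + 1 < A
    · exact Or.inl ⟨⟨a, b, α, ⟨i + 1, h⟩, Nat.succ_pos i⟩, rfl, Nat.lt_succ_self i⟩
    · right
      have hb : node A α (i + 1) = old b := by
        rw [show i + 1 = A by omega, node_last]
      simp only [hb]
      exact ⟨vert_mul_self g _, idem_mul_old g b, old_mul_idem g b⟩
  h_mul_eq_zero {x r} h := vert_mul_eq_zero_of_arr_mul_eq_zero g _ x.2.2.2.2 x.2.2.2.1.2 h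
  exists_f_mul x r := node_mul_mem g _ x.2.2.2.2 x.2.2.2.1.2 r
  c_mul_e x := old_mul_idem g _
  c_mul_self x := vert_mul_self g _
  c_mul_i x := old_mul_init g _ _ _
  i_mul_f x := init_mul_node g _ _ _
  mul_c_eq_zero {x r} h := by
    obtain ⟨f, hf⟩ := exists_theta_eq g r
    rw [← idem_mul_old, ← mul_assoc, hf]
    refine theta_mul_init_eq_zero g x.2.2.1 x.2.2.2.1.2 ?_
    rw [← hf, mul_assoc, mul_assoc, idem_mul_init, h, mul_zero]
  exists_mul_f x r := by
    obtain ⟨f, hf⟩ := exists_theta_mul_init_eq g x.2.2.1 x.2.2.2.2 x.2.2.2.1.2 r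
    refine ⟨theta A g f * vert g (old x.1), ?_, ?_, ?_⟩
    · rw [← mul_assoc, idem_mul_theta]
    · rw [mul_assoc, vert_mul_self]
    · rw [hf, mul_assoc, old_mul_init]

end StretchedAlgebra

/-! ### Paths leaving the new vertices, and finite-dimensionality -/

namespace SegmentData

variable {K : Type*} [Field K] {R : Type*} [Ring R] [Algebra K R] {e : R} {ι : Type*} [Fintype ι]
  (D : SegmentData K e ι)

/-- Downward induction along the segments: ranks grow along arrows and are bounded because there are
finitely many new vertices. -/
theorem rank_induction {P : ι → Prop}
    (H : ∀ w, (∀ w', D.rank w < D.rank w' → P w') → P w) (w : ι) : P w := by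
  obtain ⟨N, hN⟩ : ∃ N, ∀ w, D.rank w ≤ N := ⟨∑ w, D.rank w, fun w =>
    Finset.single_le_sum (fun _ _ => Nat.zero_le _) (Finset.mem_univ w)⟩
  induction hn : N - D.rank w using Nat.strong_induction_on generalizing w with
  | _ n ih =>
    refine H w fun w' hw' => ih _ ?_ w' rfl
    have := hN w'
    omega

theorem f_mul_mul_e (w : ι) (r : R) : ∃ s, D.f w * r * e = D.a w * s * e := by
  obtain ⟨k, s, hs⟩ := D.exists_f_mul w r
  exact ⟨s, by rw [hs, add_mul, smul_mul_assoc, D.f_mul_e, smul_zero, zero_add]⟩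

/-- The path which leads from `f w` to `eRe`. -/
theorem exists_out (w : ι) : ∃ o d : R, d * d = d ∧ e * d = d ∧ d * e = d ∧ D.f w * o = o ∧
    o * d = o ∧ (∀ r, o * r = 0 → d * r = 0) ∧ ∀ r, ∃ s, D.f w * r * e = o * s * e := by
  induction w using D.rank_induction with
  | H w ih =>
    rcases D.h_spec w with ⟨w', hw', hr⟩ | ⟨h1, h2, h3⟩
    · obtain ⟨o, d, hd, hed, hde, hfo, hod, hinj, hspan⟩ := ih w' hr
      refine ⟨D.a w * o, d, hd, hed, hde, by rw [← mul_assoc, D.f_mul_a], by rw [mul_assoc, hod],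
        fun r h => hinj r ?_, fun r => ?_⟩
      · rw [mul_assoc] at h
        have := D.h_mul_eq_zero h
        rwa [hw', ← mul_assoc, hfo] at this
      · obtain ⟨s, hs⟩ := D.f_mul_mul_e w r
        obtain ⟨t, ht⟩ := hspan s
        refine ⟨t, ?_⟩
        have ha : D.a w * D.f w' = D.a w := by rw [← hw', D.a_mul_h]
        calc D.f w * r * e = D.a w * D.f w' * s * e := by rw [hs, ha]
          _ = D.a w * (D.f w' * s * e) := by simp only [mul_assoc]
          _ = _ := by rw [ht]; simp only [mul_assoc]
    · exact ⟨D.a w, D.h w, h1, h2, h3, D.f_mul_a w, D.a_mul_h w, fun r => D.h_mul_eq_zero,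
        D.f_mul_mul_e w⟩

end SegmentData

namespace SegmentData

open IsIdempotentElem

variable {K : Type*} [Field K] {R : Type v} [Ring R] [Algebra K R] {e : R} {ι : Type*} [Fintype ι]
  (D : SegmentData K e ι) (he : IsIdempotentElem e)

theorem mul_add_sum_mul (r : R) : e * r + ∑ w, D.f w * r = r := by
  rw [← Finset.sum_mul, ← add_mul, D.add_sum, one_mul]

theorem mul_mul_add_sum (r : R) : r * e + ∑ w, r * D.f w = r := by
  rw [← Finset.mul_sum, ← mul_add, D.add_sum, mul_one]

section FiniteDimensional

include D in
theorem exists_finiteDimensional_idem_mul [FiniteDimensional K he.Corner] :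
    ∃ S : Submodule K R, FiniteDimensional K S ∧ ∀ r, e * r ∈ S := by
  let val : he.Corner →ₗ[K] R :=
    { toFun := fun x => x.1
      map_add' := fun _ _ => rfl
      map_smul' := fun _ _ => rfl }
  have hval : ∀ r, e * r * e ∈ LinearMap.range val := fun r =>
    ⟨⟨e * r * e, (Subsemigroup.mem_corner_iff he).2
      ⟨by rw [mul_assoc e, ← mul_assoc e e, he.eq], by rw [mul_assoc, he.eq]⟩⟩, rfl⟩
  refine ⟨LinearMap.range val ⊔ ⨆ w, (LinearMap.range val).map (LinearMap.mulRight K (D.i w)),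
    inferInstance, fun r => ?_⟩
  rw [← D.mul_mul_add_sum (e * r)]
  refine Submodule.add_mem _ (Submodule.mem_sup_left (hval r))
    (Submodule.sum_mem _ fun w _ => Submodule.mem_sup_right (Submodule.mem_iSup_of_mem w ?_))
  obtain ⟨s, h1, h2, h3⟩ := D.exists_mul_f w r
  refine ⟨s, ?_, h3.symm⟩
  have hs : s = e * s * e := by rw [h1, ← h2, mul_assoc, D.c_mul_e]
  rw [hs]
  exact hval s

include D in
-- R is the sum of eR and the f_w R. The first is spanned by eRe and its multiples by the i_w; for
-- the others, f_w R = K f_w + a_w h_w R is controlled by the next vertex on the segment.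
theorem finiteDimensional [FiniteDimensional K he.Corner] : FiniteDimensional K R := by
  obtain ⟨S, hS, heS⟩ := D.exists_finiteDimensional_idem_mul he
  have key : ∀ w, ∃ T : Submodule K R, FiniteDimensional K T ∧ ∀ r, D.f w * r ∈ T := by
    intro w
    induction w using D.rank_induction with
    | H w ih =>
      obtain ⟨T, hT, hmem⟩ : ∃ T : Submodule K R, FiniteDimensional K T ∧ ∀ r, D.h w * r ∈ T := by
        rcases D.h_spec w with ⟨w', hw', hr⟩ | ⟨_, h2, _⟩
        · rw [hw']
          exact ih w' hr
        · refine ⟨S, hS, fun r => ?_⟩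
          rw [← h2, mul_assoc]
          exact heS _
      refine ⟨(K ∙ D.f w) ⊔ T.map (LinearMap.mulLeft K (D.a w)), inferInstance, fun r => ?_⟩
      obtain ⟨k, s, h⟩ := D.exists_f_mul w r
      rw [h]
      refine Submodule.add_mem _ (Submodule.mem_sup_left (Submodule.mem_span_singleton.2 ⟨k, rfl⟩))
        (Submodule.mem_sup_right ⟨D.h w * s, hmem s, ?_⟩)
      rw [LinearMap.mulLeft_apply, ← mul_assoc, D.a_mul_h]
  choose T hT hmem using key
  have : S ⊔ ⨆ w, T w = ⊤ := by
    rw [eq_top_iff]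
    intro r _
    rw [← D.mul_add_sum_mul r]
    exact Submodule.add_mem _ (Submodule.mem_sup_left (heS r)) (Submodule.sum_mem _ fun w _ =>
      Submodule.mem_sup_right (Submodule.mem_iSup_of_mem w (hmem w r)))
  have : FiniteDimensional K (⊤ : Submodule K R) := by
    rw [← this]
    infer_instance
  exact Module.Finite.equiv Submodule.topEquiv

end FiniteDimensional

/-! ### The stratifying ideal -/

section Tensor

theorem mem_rightCorner {r : R} : r ∈ rightCorner e R ↔ r * e = r := Iff.rfl

theorem mem_leftCorner {r : R} : r ∈ leftCorner e R ↔ e * r = r := Iff.rfl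

theorem balancedTensor_smul_tmul {B M N : Type v} [Ring B] [AddCommGroup M] [Module Bᵐᵒᵖ M]
    [AddCommGroup N] [Module B N] (m : M) (b : B) (n : N) :
    (QuotientAddGroup.mk ((op b • m) ⊗ₜ[ℤ] n) : BalancedTensor B M N) =
      QuotientAddGroup.mk (m ⊗ₜ[ℤ] (b • n)) := by
  rw [← sub_eq_zero, ← QuotientAddGroup.mk_sub, QuotientAddGroup.eq_zero_iff]
  exact AddSubgroup.subset_closure ⟨m, b, n, rfl⟩

include D in
-- Every tensor can be brought to the form e ⊗ n₀ + Σ o_w ⊗ n_w with n_w in d_w R, where o_w is the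
-- path leaving f_w. Applying multiplication, then e or f_w on the left, isolates each summand, and
-- o_w can be cancelled on d_w R.
theorem cornerMul_injective : Function.Injective (cornerMul he) := by
  choose o d hd hed hde hfo hod hinj hspan using D.exists_out
  have hoe : ∀ w, o w * e = o w := fun w => by rw [← hod, mul_assoc, hde]
  let e' : rightCorner e R := ⟨e, he.eq⟩
  let o' : ι → rightCorner e R := fun w => ⟨o w, hoe w⟩
  have key : ∀ z : BalancedTensor he.Corner (rightCorner e R) (leftCorner e R),
      ∃ (n₀ : leftCorner e R) (n : ι → leftCorner e R), (∀ w, d w * (n w).1 = (n w).1) ∧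
        z = QuotientAddGroup.mk (e' ⊗ₜ[ℤ] n₀ + ∑ w, o' w ⊗ₜ[ℤ] n w) := by
    intro z
    obtain ⟨z, rfl⟩ := QuotientAddGroup.mk_surjective z
    induction z using TensorProduct.induction_on with
    | zero => exact ⟨0, 0, fun w => mul_zero _, by simp⟩
    | add x y hx hy =>
      obtain ⟨n₀, n, hn, hx⟩ := hx
      obtain ⟨m₀, m, hm, hy⟩ := hy
      refine ⟨n₀ + m₀, n + m, fun w => ?_, ?_⟩
      · change d w * ((n w).1 + (m w).1) = (n w).1 + (m w).1
        rw [mul_add, hn, hm]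
      · rw [QuotientAddGroup.mk_add, hx, hy, ← QuotientAddGroup.mk_add]
        congr 1
        simp only [Pi.add_apply, TensorProduct.tmul_add, Finset.sum_add_distrib]
        abel
    | tmul m n =>
      obtain ⟨m, hm⟩ := m
      rw [mem_rightCorner] at hm
      choose s hs using fun w => hspan w m
      have hcorner : ∀ x, e * x = x → x * e = x → x ∈ Subsemigroup.corner e := fun x h1 h2 =>
        (Subsemigroup.mem_corner_iff he).2 ⟨h1, h2⟩
      let b₀ : he.Corner := ⟨e * m, hcorner _ (by rw [← mul_assoc, he.eq])
        (by rw [mul_assoc, hm])⟩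
      let b : ι → he.Corner := fun w => ⟨d w * s w * e, hcorner _
        (by rw [← mul_assoc, ← mul_assoc, hed]) (by rw [mul_assoc, he.eq])⟩
      -- Decompose m = em + Σ f_w m and write f_w m as o_w times an element of eRe; these
      -- coefficients then move across the tensor sign.
      have hmeq : (⟨m, hm⟩ : rightCorner e R) = op b₀ • e' + ∑ w, op (b w) • o' w := by
        refine Subtype.ext ?_
        rw [AddSubgroup.coe_add, AddSubgroup.val_finsetSum]
        change m = e * (e * m) + ∑ w, o w * (d w * s w * e)
        rw [← mul_assoc, he.eq]
        nth_rw 1 [← D.mul_add_sum_mul m]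
        congr 1
        refine Finset.sum_congr rfl fun w _ => ?_
        rw [← mul_assoc, ← mul_assoc, hod, ← hs, mul_assoc, hm]
      refine ⟨b₀ • n, fun w => b w • n, fun w => ?_, ?_⟩
      · change d w * (d w * s w * e * n.1) = d w * s w * e * n.1
        simp only [← mul_assoc, hd]
      · rw [hmeq, TensorProduct.add_tmul, TensorProduct.sum_tmul]
        rw [QuotientAddGroup.mk_add, QuotientAddGroup.mk_add, balancedTensor_smul_tmul]
        congr 1
        rw [QuotientAddGroup.mk_sum, QuotientAddGroup.mk_sum]
        exact Finset.sum_congr rfl fun w _ => balancedTensor_smul_tmul _ _ _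
  rw [injective_iff_map_eq_zero]
  intro z hz
  obtain ⟨n₀, n, hn, rfl⟩ := key z
  rw [QuotientAddGroup.mk_add, QuotientAddGroup.mk_sum, map_add, map_sum, cornerMul_tmul] at hz
  change e * n₀.1 + ∑ w, o w * (n w).1 = 0 at hz
  have h0 : n₀ = 0 := by
    refine Subtype.ext ?_
    have := congr(e * $hz)
    rw [mul_add, Finset.mul_sum, Finset.sum_eq_zero fun w _ => by
      rw [← hfo, ← mul_assoc, ← mul_assoc, D.e_mul_f, zero_mul, zero_mul], add_zero, mul_zero,
      ← mul_assoc, he.eq] at this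
    exact n₀.2.symm.trans this
  have h1 : n = 0 := by
    funext w
    refine Subtype.ext ?_
    have := congr(D.f w * $hz)
    rw [mul_add, Finset.mul_sum, ← mul_assoc, D.f_mul_e, zero_mul, zero_add, mul_zero,
      Finset.sum_eq_single w, ← mul_assoc, hfo] at this
    · exact (hn w).symm.trans (hinj w _ this)
    · intro w' _ hw
      rw [← hfo, ← mul_assoc, ← mul_assoc, D.f_mul_of_ne hw.symm, zero_mul, zero_mul]
    · simp
  rw [h0, h1]
  simp

theorem range_cornerMul :
    Set.range (cornerMul he) = (TwoSidedIdeal.span {e} : TwoSidedIdeal R) := by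
  ext r
  constructor
  · rintro ⟨z, rfl⟩
    obtain ⟨z, rfl⟩ := QuotientAddGroup.mk_surjective z
    induction z using TensorProduct.induction_on with
    | zero =>
      rw [QuotientAddGroup.mk_zero, map_zero]
      exact TwoSidedIdeal.zero_mem _
    | add x y hx hy =>
      rw [QuotientAddGroup.mk_add, map_add]
      exact TwoSidedIdeal.add_mem _ hx hy
    | tmul m n =>
      rw [cornerMul_tmul, ← show m.1 * e = m.1 from m.2, mul_assoc]
      exact TwoSidedIdeal.mul_mem_left _ _ _ (TwoSidedIdeal.mul_mem_right _ _ _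
        (TwoSidedIdeal.subset_span rfl))
  · intro hr
    change r ∈ TwoSidedIdeal.span {e} at hr
    have hmul : ∀ a b : R, ∀ r ∈ Set.range (cornerMul he), a * r * b ∈ Set.range (cornerMul he) := by
      rintro a b _ ⟨z, rfl⟩
      obtain ⟨z, rfl⟩ := QuotientAddGroup.mk_surjective z
      induction z using TensorProduct.induction_on with
      | zero => exact ⟨0, by simp⟩
      | add x y hx hy =>
        obtain ⟨x', hx⟩ := hx
        obtain ⟨y', hy⟩ := hy
        exact ⟨x' + y', by rw [QuotientAddGroup.mk_add, map_add, map_add, mul_add, add_mul, hx, hy]⟩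
      | tmul m n =>
        refine ⟨QuotientAddGroup.mk ((⟨a * m.1, ?_⟩ : rightCorner e R) ⊗ₜ[ℤ]
          (⟨n.1 * b, ?_⟩ : leftCorner e R)), ?_⟩
        · rw [mem_rightCorner, mul_assoc, show m.1 * e = m.1 from m.2]
        · rw [mem_leftCorner, ← mul_assoc, show e * n.1 = n.1 from n.2]
        · rw [cornerMul_tmul, cornerMul_tmul]
          simp only [mul_assoc]
    induction hr using TwoSidedIdeal.span_induction with
    | mem x hx =>
      obtain rfl : x = e := hx
      exact ⟨QuotientAddGroup.mk ((⟨x, he.eq⟩ : rightCorner x R) ⊗ₜ[ℤ]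
        (⟨x, he.eq⟩ : leftCorner x R)), he.eq⟩
    | zero => exact ⟨0, map_zero _⟩
    | add x y _ _ hx hy =>
      obtain ⟨x', rfl⟩ := hx
      obtain ⟨y', rfl⟩ := hy
      exact ⟨x' + y', map_add _ _ _⟩
    | neg x _ hx =>
      obtain ⟨x', rfl⟩ := hx
      exact ⟨-x', map_neg _ _⟩
    | left_absorb a x _ hx => simpa using hmul a 1 x hx
    | right_absorb a x _ hx => simpa using hmul 1 a x hx

end Tensor

section Projective

/-- Each f_w m is o times an element of d(eRe). That element is unique because o can be cancelled,
so although s is merely chosen, the resulting coordinate is linear. -/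
theorem exists_coord (w : ι) : ∃ (o : rightCorner e R)
    (φ : rightCorner e R →ₗ[he.Cornerᵐᵒᵖ] he.Cornerᵐᵒᵖ),
      ∀ m : rightCorner e R, (φ m • o).1 = D.f w * m.1 := by
  obtain ⟨o, d, hd, hed, hde, hfo, hod, hinj, hspan⟩ := D.exists_out w
  have hoe : o * e = o := by rw [← hod, mul_assoc, hde]
  choose s hs using hspan
  have hcorner : ∀ r, d * s r * e ∈ Subsemigroup.corner e := fun r =>
    (Subsemigroup.mem_corner_iff he).2
      ⟨by rw [← mul_assoc, ← mul_assoc, hed], by rw [mul_assoc, he.eq]⟩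
  have hq : ∀ m : rightCorner e R, o * (d * s m.1 * e) = D.f w * m.1 := fun m => by
    rw [← mul_assoc, ← mul_assoc, hod, ← hs, mul_assoc, show m.1 * e = m.1 from m.2]
  have hinj' : ∀ x y, d * x = x → d * y = y → o * x = o * y → x = y := fun x y hx hy h => by
    have := hinj (x - y) (by rw [mul_sub, h, sub_self])
    rwa [mul_sub, hx, hy, sub_eq_zero] at this
  have hdq : ∀ r, d * (d * s r * e) = d * s r * e := fun r => by simp only [← mul_assoc, hd]
  refine ⟨⟨o, hoe⟩, { toFun := fun m => op ⟨d * s m.1 * e, hcorner m.1⟩,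
                      map_add' := fun m n => ?_, map_smul' := fun b m => ?_ }, fun m => hq m⟩
  · refine unop_injective (Subtype.ext (hinj' _ _ (hdq _) ?_ ?_))
    · change d * (d * s m.1 * e + d * s n.1 * e) = d * s m.1 * e + d * s n.1 * e
      rw [mul_add, hdq, hdq]
    · change o * (d * s (m + n).1 * e) = o * (d * s m.1 * e + d * s n.1 * e)
      rw [hq, mul_add, hq, hq]
      exact mul_add _ _ _
  · refine unop_injective (Subtype.ext (hinj' _ _ (hdq _) ?_ ?_))
    · change d * (d * s m.1 * e * b.unop.1) = d * s m.1 * e * b.unop.1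
      rw [← mul_assoc d, hdq]
    · change o * (d * s (b • m).1 * e) = o * (d * s m.1 * e * b.unop.1)
      rw [hq, ← mul_assoc o, hq, mul_assoc]
      rfl

include D in
-- The coordinates reassemble m = em + Σ f_w m; the index `none` stands for the summand eRe. Besides
-- projectivity, this explicit form later gives the estimate of injective dimensions.
theorem exists_dualBasis : ∃ (x : Option ι → rightCorner e R)
    (φ : Option ι → rightCorner e R →ₗ[he.Cornerᵐᵒᵖ] he.Cornerᵐᵒᵖ),
      ∀ m : rightCorner e R, ∑ k, φ k m • x k = m := by
  choose o φ h using D.exists_coord he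
  let φ₀ : rightCorner e R →ₗ[he.Cornerᵐᵒᵖ] he.Cornerᵐᵒᵖ :=
    { toFun := fun m => op ⟨e * m.1, (Subsemigroup.mem_corner_iff he).2
        ⟨by rw [← mul_assoc, he.eq], by rw [mul_assoc, show m.1 * e = m.1 from m.2]⟩⟩
      map_add' := fun m n => unop_injective (Subtype.ext (mul_add e m.1 n.1))
      map_smul' := fun b m => unop_injective (Subtype.ext (mul_assoc e m.1 b.unop.1).symm) }
  refine ⟨fun k => k.elim ⟨e, he.eq⟩ o, fun k => k.elim φ₀ φ, fun m => Subtype.ext ?_⟩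
  rw [Fintype.sum_option, AddSubgroup.coe_add, AddSubgroup.val_finsetSum]
  conv_rhs => rw [← D.mul_add_sum_mul m.1]
  congr 1
  · change e * (e * m.1) = e * m.1
    rw [← mul_assoc, he.eq]
  · exact Finset.sum_congr rfl fun w _ => h w m

include D in
theorem projective_rightCorner : Module.Projective he.Cornerᵐᵒᵖ (rightCorner e R) := by
  obtain ⟨x, φ, h⟩ := D.exists_dualBasis he
  refine Module.Projective.of_split (M := Option ι → he.Cornerᵐᵒᵖ) (LinearMap.pi φ)
    (∑ k, LinearMap.toSpanSingleton he.Cornerᵐᵒᵖ _ (x k) ∘ₗ LinearMap.proj k) ?_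
  ext m
  rw [LinearMap.comp_apply, LinearMap.sum_apply]
  exact congrArg Subtype.val (h m)

include D in
theorem isStratifyingIdeal : IsStratifyingIdeal he where
  mul_injective := D.cornerMul_injective he
  range_mul := range_cornerMul he
  tor_eq_zero n hn := by
    obtain ⟨n, rfl⟩ := Nat.exists_eq_succ_of_ne_zero hn.ne'
    have := D.projective_rightCorner he
    have : Projective (ModuleCat.of he.Cornerᵐᵒᵖ (rightCorner e R)) :=
      (IsProjective.iff_projective _).1 this
    exact Functor.isZero_leftDerived_obj_projective_succ _ n _

end Projective

end SegmentData

/-! ### Exactness for finite-dimensional modules and for the functor (-)e -/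

section FinDim

variable {K : Type u} [Field K] {S : Type v} [Ring S] [Algebra K S]

instance : (isFinDim K S).ι.PreservesHomology where
  preservesKernels := (isFinDim K S).preservesKernels_ι
  preservesCokernels := (isFinDim K S).preservesCokernels_ι

instance : Limits.PreservesFiniteLimits (isFinDim K S).ι :=
  have h : (isFinDim K S).ι.PreservesHomology ↔ Limits.PreservesFiniteLimits _ ∧
      Limits.PreservesFiniteColimits _ :=
    (isFinDim K S).ι.exact_tfae.out 2 3
  (h.1 inferInstance).1

instance : Limits.PreservesFiniteColimits (isFinDim K S).ι :=
  have h : (isFinDim K S).ι.PreservesHomology ↔ Limits.PreservesFiniteLimits _ ∧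
      Limits.PreservesFiniteColimits _ :=
    (isFinDim K S).ι.exact_tfae.out 2 3
  (h.1 inferInstance).2

theorem isFinDim.epi_iff {X Y : (isFinDim K S).FullSubcategory} (f : X ⟶ Y) :
    Epi f ↔ Function.Surjective f.hom.hom := by
  rw [← ModuleCat.epi_iff_surjective]
  exact ⟨fun _ => inferInstanceAs (Epi ((isFinDim K S).ι.map f)),
    fun h => (isFinDim K S).ι.epi_of_epi_map h⟩

/-- The inclusion into all modules is faithful and preserves homology, so exactness can be tested on
elements. -/
theorem isFinDim.shortExact_iff (T : ShortComplex (isFinDim K S).FullSubcategory) :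
    T.ShortExact ↔ Function.Injective T.f.hom.hom ∧ Function.Exact T.f.hom.hom T.g.hom.hom ∧
      Function.Surjective T.g.hom.hom := by
  have h1 : T.ShortExact ↔ (T.map (isFinDim K S).ι).ShortExact := by
    constructor
    · exact fun h => h.map_of_exact _
    · intro h
      exact ShortComplex.ShortExact.mk' ((T.exact_map_iff_of_faithful (isFinDim K S).ι).1 h.exact)
        ((isFinDim K S).ι.mono_of_mono_map h.mono_f) ((isFinDim K S).ι.epi_of_epi_map h.epi_g)
  rw [h1]
  constructor
  · intro h
    exact ⟨(ModuleCat.mono_iff_injective _).1 h.mono_f,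
      (ShortComplex.ShortExact.moduleCat_exact_iff_function_exact _).1 h.exact,
      (ModuleCat.epi_iff_surjective _).1 h.epi_g⟩
  · rintro ⟨h1, h2, h3⟩
    exact ShortComplex.ShortExact.mk'
      ((ShortComplex.ShortExact.moduleCat_exact_iff_function_exact _).2 h2)
      ((ModuleCat.mono_iff_injective _).2 h1) ((ModuleCat.epi_iff_surjective _).2 h3)

theorem isFinDim.projective {X : (isFinDim K S).FullSubcategory} (h : Module.Projective S X.obj) :
    Projective X where
  factors {E Y} f p hp := by
    obtain ⟨l, hl⟩ := Module.projective_lifting_property p.hom.hom f.hom.hom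
      ((isFinDim.epi_iff p).1 hp)
    refine ⟨ObjectProperty.homMk (ModuleCat.ofHom l), ?_⟩
    ext x
    exact congr($hl x)

variable (K) in
/-- A finite-dimensional module as an object of the category of these modules. -/
abbrev isFinDim.of (M : Type v) [AddCommGroup M] [Module S M] (h : isFinDim K S (ModuleCat.of S M)) :
    (isFinDim K S).FullSubcategory :=
  ⟨ModuleCat.of S M, h⟩

theorem isFinDim_of_finite [FiniteDimensional K S] (M : Type v) [AddCommGroup M] [Module S M]
    [Module.Finite S M] : isFinDim K S (ModuleCat.of S M) := by
  let _ : Module K M := Module.restrictScalars K S M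
  have : IsScalarTower K S M := IsScalarTower.restrictScalars K S M
  have : FiniteDimensional K M := Module.Finite.trans S M
  exact this

end FinDim

section Functor

variable {K : Type u} [Field K] {R : Type v} [Ring R] [Algebra K R] {e : R}
  (he : IsIdempotentElem e)

instance : (resFunctor he K).Additive where
  map_add := rfl

/-- A preimage of an element fixed by e stays a preimage after multiplication by e, and then lies in
the corner. -/
theorem resFunctor_map_shortExact {T : ShortComplex (FinDimMod K R)} (hT : T.ShortExact) :
    (T.map (resFunctor he K)).ShortExact := by
  rw [isFinDim.shortExact_iff] at hT ⊢
  obtain ⟨h1, h2, h3⟩ := hT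
  refine ⟨fun x y h => Subtype.ext (h1 congr(($h).1)), fun y => ⟨fun hy => ?_, ?_⟩, fun z => ?_⟩
  · obtain ⟨x, hx⟩ := (h2 y.1).1 congr(($hy).1)
    refine ⟨⟨op e • x, ?_⟩, Subtype.ext ?_⟩
    · change op e • op e • x = op e • x
      rw [smul_smul, ← op_mul, he.eq]
    · change T.f.hom.hom (op e • x) = y.1
      rw [map_smul, hx]
      exact y.2
  · rintro ⟨x, rfl⟩
    exact Subtype.ext ((h2 _).2 ⟨x.1, rfl⟩)
  · obtain ⟨y, hy⟩ := h3 z.1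
    refine ⟨⟨op e • y, ?_⟩, Subtype.ext ?_⟩
    · change op e • op e • y = op e • y
      rw [smul_smul, ← op_mul, he.eq]
    · change T.g.hom.hom (op e • y) = z.1
      rw [map_smul, hy]
      exact z.2

instance : Limits.PreservesFiniteLimits (resFunctor he K) :=
  have h : _ ↔ Limits.PreservesFiniteLimits _ ∧ Limits.PreservesFiniteColimits _ :=
    (resFunctor he K).exact_tfae.out 0 3
  (h.1 fun _ h => resFunctor_map_shortExact he h).1

instance : Limits.PreservesFiniteColimits (resFunctor he K) :=
  have h : _ ↔ Limits.PreservesFiniteLimits _ ∧ Limits.PreservesFiniteColimits _ :=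
    (resFunctor he K).exact_tfae.out 0 3
  (h.1 fun _ h => resFunctor_map_shortExact he h).2

end Functor

/-! ### Comparison of Ext groups: resolving classes and dimension shifts -/

section Ext

open Limits Abelian

universe w' v₁ v₂ u₁ u₂

variable {C : Type u₁} [Category.{v₁} C] [Abelian C] {D : Type u₂} [Category.{v₂} D] [Abelian D]

attribute [local simp] Ext.mapExactFunctor_comp Ext.mapExactFunctor_mk₀ Ext.mapExactFunctor_extClass

attribute [local instance] Ext.subsingleton_of_projective in
/-- An exact functor induces isomorphisms on `Ext(X, -)` for all `X` in a class of objects on which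
it is fully faithful, if the class is closed under syzygies with respect to projective objects whose
images are projective. -/
theorem mapExt_bijective_of_resolving [HasExt.{w} C] [HasExt.{w'} D] (F : C ⥤ D) [F.Additive]
    [PreservesFiniteLimits F] [PreservesFiniteColimits F] (G : ObjectProperty C)
    (hG : ∀ X, G X → ∀ Y, Function.Bijective (F.map : (X ⟶ Y) → (F.obj X ⟶ F.obj Y)))
    (hres : ∀ X, G X → ∃ (X' P : C) (f : X' ⟶ P) (p : P ⟶ X) (h : f ≫ p = 0),
      (ShortComplex.mk f p h).ShortExact ∧ G X' ∧ G P ∧ Projective P ∧ Projective (F.obj P))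
    (X Y : C) (hX : G X) (n : ℕ) : Function.Bijective (F.mapExtAddHom X Y n) := by
  induction n generalizing X with
  | zero =>
    have := hG X hX Y
    simpa [Ext.mapExactFunctor₀] using this
  | succ n hn =>
    obtain ⟨X', P, f, p, h, hS, hX', hGP, hP, hFP⟩ := hres X hX
    let S := ShortComplex.mk f p h
    have : Projective S.X₂ := hP
    have : Projective (S.map F).X₂ := hFP
    have hFS : (S.map F).ShortExact := hS.map_of_exact F
    -- As P and its image are projective, Ext^{n+1} at X is on both sides the cokernel of Ext^n at P
    -- → Ext^n at X'. The induction hypothesis at X' and surjectivity at P suffice.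
    exact AddMonoidHom.bijective_of_surjective_of_bijective_of_right_exact _ _ _ _
      (F.mapExtAddHom S.X₂ Y n) (F.mapExtAddHom S.X₁ Y n) (F.mapExtAddHom S.X₃ Y (n + 1))
      (by cat_disch) (by cat_disch)
      ((ShortComplex.ab_exact_iff_function_exact _).1
        (Ext.contravariant_sequence_exact₁' hS Y n (n + 1) (add_comm 1 n)))
      ((ShortComplex.ab_exact_iff_function_exact _).1
        (Ext.contravariant_sequence_exact₁' hFS (F.obj Y) n (n + 1) (add_comm 1 n)))
      (hn _ hGP).surjective (hn _ hX')
      (fun x₃ ↦ Ext.contravariant_sequence_exact₃ hS _ x₃ (by subsingleton) (add_comm 1 n))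
      (fun y₃ ↦ Ext.contravariant_sequence_exact₃ hFS _ y₃ (by subsingleton) (add_comm 1 n))

variable {T : ShortComplex C} (hT : T.ShortExact) (Y : C)

include hT in
-- The neighbours in the long exact sequence are Ext^j and Ext^{j+1} of the quotient, so j ≥ 2 is
-- enough.
theorem precomp_bijective_of_hasProjectiveDimensionLT_X₃ [HasExt.{w} C]
    [HasProjectiveDimensionLT T.X₃ 2] {j : ℕ} (hj : 2 ≤ j) :
    Function.Bijective ((Ext.mk₀ T.f).precomp Y (zero_add j)) := by
  constructor
  · rw [injective_iff_map_eq_zero]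
    intro x hx
    obtain ⟨y, rfl⟩ := Ext.contravariant_sequence_exact₂ hT Y x hx
    rw [y.eq_zero_of_hasProjectiveDimensionLT 2 hj, Ext.comp_zero]
  · intro x
    exact Ext.contravariant_sequence_exact₁ hT Y x (add_comm 1 j)
      (Ext.eq_zero_of_hasProjectiveDimensionLT _ 2 (by omega))

include hT in
-- Here the neighbours are Ext^{j-1} and Ext^j of the submodule. The lower one forces j > 2, which
-- is the source of the bound in the theorem.
theorem precomp_bijective_of_hasProjectiveDimensionLT_X₁ [HasExt.{w} C]
    [HasProjectiveDimensionLT T.X₁ 2] {j : ℕ} (hj : 2 < j) :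
    Function.Bijective ((Ext.mk₀ T.g).precomp Y (zero_add j)) := by
  constructor
  · rw [injective_iff_map_eq_zero]
    intro x hx
    obtain ⟨y, rfl⟩ := Ext.contravariant_sequence_exact₃ hT Y x hx
      (n₀ := j - 1) (by omega)
    rw [y.eq_zero_of_hasProjectiveDimensionLT 2 (by omega), Ext.comp_zero]
  · intro x
    exact Ext.contravariant_sequence_exact₂ hT Y x
      (Ext.eq_zero_of_hasProjectiveDimensionLT _ 2 (by omega))

theorem precomp_bijective_of_isIso [HasExt.{w} C] {X X' : C} (f : X ⟶ X') [IsIso f] (j : ℕ) :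
    Function.Bijective ((Ext.mk₀ f).precomp Y (zero_add j)) := by
  constructor
  · rw [injective_iff_map_eq_zero]
    intro x hx
    have : (Ext.mk₀ (inv f)).comp ((Ext.mk₀ f).comp x (zero_add j)) (zero_add j) = 0 := by
      rw [show (Ext.mk₀ f).comp x (zero_add j) = 0 from hx, Ext.comp_zero]
    simpa using this
  · intro x
    exact ⟨(Ext.mk₀ (inv f)).comp x (zero_add j), by simp⟩

end Ext

/-! ### Modules annihilated by e -/

/-- The left ideal `Ss` generated by an idempotent `s`. -/
def idemIdeal {S : Type*} [Ring S] (s : S) : Submodule S S where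
  carrier := {x | x * s = x}
  add_mem' {x y} hx hy := by
    change (x + y) * s = x + y
    rw [add_mul, show x * s = x from hx, show y * s = y from hy]
  zero_mem' := zero_mul s
  smul_mem' a x hx := by
    change a * x * s = a * x
    rw [mul_assoc, show x * s = x from hx]

theorem mem_idemIdeal {S : Type*} [Ring S] {s x : S} : x ∈ idemIdeal s ↔ x * s = x := Iff.rfl

theorem projective_idemIdeal {S : Type*} [Ring S] {s : S} (hs : s * s = s) :
    Module.Projective S (idemIdeal s) := by
  refine Module.Projective.of_split (idemIdeal s).subtype
    ((LinearMap.toSpanSingleton S S s).codRestrict (idemIdeal s) fun x => ?_) ?_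
  · change x * s * s = x * s
    rw [mul_assoc, hs]
  · ext x
    exact x.2

namespace SegmentData

variable {K : Type u} [Field K] {R : Type v} [Ring R] [Algebra K R] {e : R}
  {ι : Type*} [Fintype ι] (D : SegmentData K e ι)

section RightModule

variable {M : Type*} [AddCommGroup M] [Module Rᵐᵒᵖ M]

theorem smul_add_sum_smul (m : M) : op e • m + ∑ w, op (D.f w) • m = m := by
  rw [← Finset.sum_smul, ← add_smul, ← Finset.op_sum, ← MulOpposite.op_add, D.add_sum, op_one, one_smul]

/-- A nonzero module which is annihilated by `e` contains a nonzero element at one of the `f w`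
which is annihilated by the arrow starting there. -/
theorem exists_ne_zero_of_annihilated (hM : ∀ m : M, op e • m = 0) [Nontrivial M] :
    ∃ (w : ι) (m : M), m ≠ 0 ∧ op (D.f w) • m = m ∧ op (D.a w) • m = 0 := by
  have key : ∀ w, (∃ m : M, op (D.f w) • m ≠ 0) →
      ∃ (w : ι) (m : M), m ≠ 0 ∧ op (D.f w) • m = m ∧ op (D.a w) • m = 0 := by
    intro w
    induction w using D.rank_induction with
    | H w ih =>
      rintro ⟨m, hm⟩
      by_cases ha : op (D.a w) • op (D.f w) • m = 0
      · exact ⟨w, op (D.f w) • m, hm, by rw [smul_smul, ← op_mul, D.f_mul_self], ha⟩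
      -- Otherwise move along the arrow. The end cannot lie in eRe, since e annihilates M, so it is
      -- a new vertex of larger rank.
      · have hh : op (D.h w) • op (D.a w) • op (D.f w) • m ≠ 0 := by
          rwa [smul_smul, ← op_mul, D.a_mul_h]
        rcases D.h_spec w with ⟨w', hw', hr⟩ | ⟨_, _, h3⟩
        · exact ih w' hr ⟨_, hw' ▸ hh⟩
        · refine absurd ?_ hh
          rw [← h3, op_mul, mul_smul, hM]
  obtain ⟨m, hm⟩ := exists_ne (0 : M)
  by_contra h
  have h0 : ∀ w, op (D.f w) • m = 0 := fun w => by
    by_contra hw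
    exact h (key w ⟨m, hw⟩)
  apply hm
  rw [← D.smul_add_sum_smul m, hM, zero_add]
  exact Finset.sum_eq_zero fun w _ => h0 w

end RightModule

theorem op_smul_smul_eq_zero_iff {M : Type*} [AddCommGroup M] [Module Rᵐᵒᵖ M] {k : K} {r : R}
    {m : M} (hr : op r • m = m) (hm : m ≠ 0) : op (k • r) • m = 0 ↔ k = 0 := by
  have h : op (k • r) • m = op (algebraMap K R k) • m := by
    rw [Algebra.smul_def, Algebra.commutes, op_mul, mul_smul, hr]
  rw [h]
  constructor
  · intro h0
    by_contra hk
    apply hm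
    rw [← one_smul Rᵐᵒᵖ m, ← op_one, ← map_one (algebraMap K R), ← mul_inv_cancel₀ hk, map_mul,
      op_mul, mul_smul, h0, smul_zero]
  · rintro rfl
    rw [map_zero, op_zero, zero_smul]

theorem h_mul_self (w : ι) : D.h w * D.h w = D.h w := by
  rcases D.h_spec w with ⟨w', hw', _⟩ | ⟨h, _, _⟩
  · rw [hw', D.f_mul_self]
  · exact h

section ProjectiveDimension

variable [FiniteDimensional K R]

/-- The right ideal `sR` generated by an idempotent `s`, as an object. -/
noncomputable abbrev idemModule (K : Type u) [Field K] {R : Type v} [Ring R] [Algebra K R]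
    [FiniteDimensional K R] (s : R) : FinDimMod K R :=
  isFinDim.of K (idemIdeal (op s)) (by
    have : IsNoetherian K Rᵐᵒᵖ := inferInstance
    have : IsNoetherian Rᵐᵒᵖ Rᵐᵒᵖ := isNoetherian_of_tower K inferInstance
    exact isFinDim_of_finite _)

theorem projective_idemModule {s : R} (hs : s * s = s) : Projective (idemModule K s) :=
  isFinDim.projective (projective_idemIdeal (by rw [← op_mul, hs]))

/-- A module generated by an element at `f w` which is annihilated by the arrow starting there has
projective dimension at most one. -/
theorem hasProjectiveDimensionLT_span_singleton {M : FinDimMod K R} (w : ι) (m : M.obj)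
    (hm : m ≠ 0) (hf : op (D.f w) • m = m) (ha : op (D.a w) • m = 0)
    (h : isFinDim K Rᵐᵒᵖ (ModuleCat.of _ (Rᵐᵒᵖ ∙ m))) :
    HasProjectiveDimensionLT (isFinDim.of K (Rᵐᵒᵖ ∙ m) h) 2 := by
  let i : idemIdeal (op (D.h w)) →ₗ[Rᵐᵒᵖ] idemIdeal (op (D.f w)) :=
    (LinearMap.toSpanSingleton Rᵐᵒᵖ Rᵐᵒᵖ (op (D.a w)) ∘ₗ (idemIdeal (op (D.h w))).subtype).codRestrict
      _ fun x => by
        change x.1 * op (D.a w) * op (D.f w) = x.1 * op (D.a w)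
        rw [mul_assoc, ← op_mul, D.f_mul_a]
  let p : idemIdeal (op (D.f w)) →ₗ[Rᵐᵒᵖ] (Rᵐᵒᵖ ∙ m) :=
    (LinearMap.toSpanSingleton Rᵐᵒᵖ M.obj m ∘ₗ (idemIdeal (op (D.f w))).subtype).codRestrict
      _ fun x => Submodule.smul_mem _ _ (Submodule.mem_span_singleton_self m)
  have hpi : ∀ x, p (i x) = 0 := fun x => Subtype.ext (by
    change (x.1 * op (D.a w)) • m = 0
    rw [mul_smul, ha, smul_zero])
  let T : ShortComplex (FinDimMod K R) := ShortComplex.mk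
    (X₁ := idemModule K (D.h w)) (X₂ := idemModule K (D.f w)) (X₃ := isFinDim.of K (Rᵐᵒᵖ ∙ m) h)
    (ObjectProperty.homMk (ModuleCat.ofHom i)) (ObjectProperty.homMk (ModuleCat.ofHom p)) (by
      ext x
      exact congrArg Subtype.val (hpi x))
  have hT : T.ShortExact := by
    rw [isFinDim.shortExact_iff]
    refine ⟨?_, fun y => ⟨fun hy => ?_, ?_⟩, ?_⟩
    · refine (injective_iff_map_eq_zero i).2 fun x hx => Subtype.ext ?_
      have hx : x.1 * op (D.a w) = 0 := congrArg Subtype.val hx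
      have hx' : D.a w * unop x.1 = 0 := op_injective hx
      have := D.h_mul_eq_zero hx'
      rw [← x.2]
      exact unop_injective this
    -- An element k f_w + a_w s annihilates m only if k = 0, because m is nonzero at f_w and killed
    -- by a_w. So the kernel of f_w R → mR is a_w R.
    · obtain ⟨k, s, hs⟩ := D.exists_f_mul w (unop y.1)
      have hy1 : D.f w * unop y.1 = unop y.1 := congrArg unop y.2
      rw [hy1] at hs
      have hy2 : y.1 • m = 0 := congrArg Subtype.val hy
      rw [← op_unop y.1, hs, MulOpposite.op_add, add_smul, op_mul, mul_smul, ha, smul_zero, add_zero,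
        op_smul_smul_eq_zero_iff hf hm] at hy2
      rw [hy2, zero_smul, zero_add] at hs
      refine ⟨⟨op (D.h w * s), ?_⟩, Subtype.ext (unop_injective ?_)⟩
      · rw [mem_idemIdeal, ← op_mul, ← mul_assoc, D.h_mul_self]
      · change D.a w * (D.h w * s) = unop y.1
        rw [← mul_assoc, D.a_mul_h, hs]
    · rintro ⟨x, rfl⟩
      exact hpi x
    · rintro ⟨y, hy⟩
      obtain ⟨r, rfl⟩ := Submodule.mem_span_singleton.1 hy
      refine ⟨⟨r * op (D.f w), ?_⟩, Subtype.ext ?_⟩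
      · rw [mem_idemIdeal, mul_assoc, ← op_mul, D.f_mul_self]
      · change (r * op (D.f w)) • m = r • m
        rw [mul_smul, hf]
  have h1 : Projective T.X₁ := projective_idemModule (D.h_mul_self w)
  have h2 : Projective T.X₂ := projective_idemModule (D.f_mul_self w)
  exact hT.hasProjectiveDimensionLT_X₃ 1 inferInstance inferInstance

end ProjectiveDimension

end SegmentData

section Submodules

variable {K : Type u} [Field K] {S : Type v} [Ring S] [Algebra K S]

theorem isFinDim_submodule {M : Type v} [AddCommGroup M] [Module S M]
    (hM : isFinDim K S (ModuleCat.of S M)) (N : Submodule S M) :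
    isFinDim K S (ModuleCat.of S N) :=
  have : Mono (ModuleCat.ofHom N.subtype) := (ModuleCat.mono_iff_injective _).2 N.injective_subtype
  (isFinDim K S).prop_of_mono (ModuleCat.ofHom N.subtype) hM

theorem isFinDim_quotient {M : Type v} [AddCommGroup M] [Module S M]
    (hM : isFinDim K S (ModuleCat.of S M)) (N : Submodule S M) :
    isFinDim K S (ModuleCat.of S (M ⧸ N)) :=
  have : Epi (ModuleCat.ofHom N.mkQ) := (ModuleCat.epi_iff_surjective _).2 N.mkQ_surjective
  (isFinDim K S).prop_of_epi (ModuleCat.ofHom N.mkQ) hM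

/-- The short complex `N → M → M/N`. -/
def submoduleComplex (M : (isFinDim K S).FullSubcategory) (N : Submodule S M.obj) :
    ShortComplex (isFinDim K S).FullSubcategory :=
  ShortComplex.mk (X₁ := isFinDim.of K N (isFinDim_submodule M.property N)) (X₂ := M)
    (X₃ := isFinDim.of K (M.obj ⧸ N) (isFinDim_quotient M.property N))
    (ObjectProperty.homMk (ModuleCat.ofHom N.subtype))
    (ObjectProperty.homMk (ModuleCat.ofHom N.mkQ)) (by
      ext x
      exact (Submodule.Quotient.mk_eq_zero N).2 x.2)

theorem submoduleComplex_shortExact (M : (isFinDim K S).FullSubcategory)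
    (N : Submodule S M.obj) : (submoduleComplex M N).ShortExact := by
  rw [isFinDim.shortExact_iff]
  exact ⟨N.injective_subtype, LinearMap.exact_subtype_mkQ N, N.mkQ_surjective⟩

open scoped ModuleCat in
theorem finrank_submoduleComplex_X₃_lt (M : (isFinDim K S).FullSubcategory)
    {N : Submodule S M.obj} (hN : N ≠ ⊥) :
    Module.finrank K (submoduleComplex M N).X₃.obj < Module.finrank K M.obj := by
  have : FiniteDimensional K M.obj := M.property
  let p : M.obj →ₗ[K] (submoduleComplex M N).X₃.obj :=
    (submoduleComplex M N).g.hom.hom.restrictScalars K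
  have hp : Function.Surjective p := N.mkQ_surjective
  rw [← LinearMap.finrank_range_add_finrank_ker p, LinearMap.range_eq_top.2 hp, finrank_top]
  obtain ⟨x, hx, h0⟩ := N.exists_mem_ne_zero_of_ne_bot hN
  refine Nat.lt_add_of_pos_right (Module.finrank_pos_iff_exists_ne_zero.2 ⟨⟨x, ?_⟩, ?_⟩)
  · exact (Submodule.Quotient.mk_eq_zero N).2 hx
  · exact fun h => h0 congr(($h).1)

/-- The short complex `ker p → M → M'` of a homomorphism `p`. -/
def kerComplex {M M' : (isFinDim K S).FullSubcategory} (p : M.obj →ₗ[S] M'.obj) :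
    ShortComplex (isFinDim K S).FullSubcategory :=
  ShortComplex.mk (X₁ := isFinDim.of K (LinearMap.ker p) (isFinDim_submodule M.property _))
    (X₂ := M) (X₃ := M')
    (ObjectProperty.homMk (ModuleCat.ofHom (LinearMap.ker p).subtype))
    (ObjectProperty.homMk (ModuleCat.ofHom p)) (by
      ext x
      exact x.2)

theorem kerComplex_shortExact {M M' : (isFinDim K S).FullSubcategory} (p : M.obj →ₗ[S] M'.obj)
    (hp : Function.Surjective p) : (kerComplex p).ShortExact := by
  rw [isFinDim.shortExact_iff]
  exact ⟨(LinearMap.ker p).injective_subtype, LinearMap.exact_subtype_ker_map p, hp⟩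

theorem isFinDim.isZero (M : (isFinDim K S).FullSubcategory) [Subsingleton M.obj] :
    Limits.IsZero M := by
  rw [Limits.IsZero.iff_id_eq_zero]
  ext x
  exact Subsingleton.elim _ _

end Submodules

namespace SegmentData

variable {K : Type u} [Field K] {R : Type v} [Ring R] [Algebra K R] {e : R}
  {ι : Type*} [Fintype ι] (D : SegmentData K e ι) [FiniteDimensional K R]

open scoped ModuleCat in
include D in
/-- A module annihilated by `e` has projective dimension at most one. -/
theorem hasProjectiveDimensionLT_of_annihilated (M : FinDimMod K R)
    (hM : ∀ m : M.obj, op e • m = 0) : HasProjectiveDimensionLT M 2 := by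
  induction hn : Module.finrank K M.obj using Nat.strong_induction_on generalizing M with
  | _ n ih =>
    rcases subsingleton_or_nontrivial M.obj with h | h
    · have := (isFinDim.isZero M).hasProjectiveDimensionLT_zero
      exact hasProjectiveDimensionLT_of_ge M 0 2 (Nat.zero_le _)
    · obtain ⟨w, m, hm, hf, ha⟩ := D.exists_ne_zero_of_annihilated hM
      have hS := submoduleComplex_shortExact M (Rᵐᵒᵖ ∙ m)
      refine hS.hasProjectiveDimensionLT_X₂ 2
        (D.hasProjectiveDimensionLT_span_singleton w m hm hf ha _) ?_
      have : FiniteDimensional K M.obj := M.property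
      refine ih _ ?_ (submoduleComplex M (Rᵐᵒᵖ ∙ m)).X₃ (fun x => ?_) rfl
      · rw [← hn]
        exact finrank_submoduleComplex_X₃_lt M ((Submodule.span_singleton_eq_bot).not.2 hm)
      · obtain ⟨x, rfl⟩ := Submodule.mkQ_surjective _ x
        exact ((Rᵐᵒᵖ ∙ m).mkQ.map_smul (op e) x).symm.trans (by rw [hM]; exact map_zero _)

end SegmentData

/-! ### Modules on which (-)e is fully faithful -/

namespace SegmentData

variable {K : Type u} [Field K] {R : Type v} [Ring R] [Algebra K R] {e : R}
  {ι : Type*} [Fintype ι] (D : SegmentData K e ι)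

section Modules

variable (M : Type w) [AddCommGroup M] [Module Rᵐᵒᵖ M]

/-- The submodule `MeR` of `M` generated by `Me`. -/
abbrev _root_.cornerSpan (e : R) : Submodule Rᵐᵒᵖ M := Submodule.span Rᵐᵒᵖ (rightCorner e M)

variable {M}

include D in
theorem mem_rightCorner_of_c_smul {w : ι} {m : M} (h : op (D.c w) • m = m) :
    m ∈ rightCorner e M := by
  change op e • m = m
  rw [← h, smul_smul, ← op_mul, D.c_mul_e]

/-- On a generator n in Me one has n r f_w = n(e r f_w), and e r f_w factors through the path i_w;
this passes to sums and multiples. -/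
theorem exists_i_smul_eq {m : M} (hm : m ∈ cornerSpan M e) (w : ι) :
    ∃ m' ∈ cornerSpan M e, op (D.c w) • m' = m' ∧ op (D.i w) • m' = op (D.f w) • m := by
  -- The claim is made for all multiples of m so that the induction over the span survives the
  -- scalar step.
  have key : ∀ r : R, ∃ m', op (D.c w) • m' = m' ∧
      op (D.i w) • m' = op (D.f w) • op r • m := by
    induction hm using Submodule.span_induction with
    | mem n hn =>
      intro r
      obtain ⟨s, hs1, hs2, hs3⟩ := D.exists_mul_f w r
      refine ⟨op s • n, ?_, ?_⟩
      · rw [smul_smul, ← op_mul, hs2]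
      · rw [smul_smul, ← op_mul, ← hs3, op_mul, op_mul, mul_smul, mul_smul,
          show op e • n = n from hn]
    | zero => exact fun r => ⟨0, smul_zero _, by simp only [smul_zero]⟩
    | add x y _ _ hx hy =>
      intro r
      obtain ⟨x', hx1, hx2⟩ := hx r
      obtain ⟨y', hy1, hy2⟩ := hy r
      exact ⟨x' + y', by rw [smul_add, hx1, hy1], by simp only [smul_add, hx2, hy2]⟩
    | smul a x _ hx =>
      intro r
      obtain ⟨x', hx1, hx2⟩ := hx (unop a * r)
      exact ⟨x', hx1, by rw [hx2, op_mul, mul_smul, op_unop]⟩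
  obtain ⟨m', h1, h2⟩ := key 1
  rw [op_one, one_smul] at h2
  exact ⟨m', Submodule.subset_span (D.mem_rightCorner_of_c_smul h1), h1, h2⟩

theorem mem_of_smul_mem (N : Submodule Rᵐᵒᵖ M) {m : M} (he : op e • m ∈ N)
    (hf : ∀ w, op (D.f w) • m ∈ N) : m ∈ N := by
  rw [← D.smul_add_sum_smul m]
  exact N.add_mem he (N.sum_mem fun w _ => hf w)

variable (M) in
/-- Multiplication by the paths into the added vertices is injective on `M`. -/
def IsTorsionFree : Prop :=
  ∀ (w : ι) (m : M), op (D.c w) • m = m → op (D.i w) • m = 0 → m = 0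

variable {M' : Type*} [AddCommGroup M'] [Module Rᵐᵒᵖ M']

theorem op_smul_mem_rightCorner (he : IsIdempotentElem e) (m : M) :
    op e • m ∈ rightCorner e M := by
  change op e • op e • m = op e • m
  rw [smul_smul, ← op_mul, he.eq]

/-- For n in the kernel, n f_w = m' i_w with m' at c_w. Then p(m') i_w = 0, so p(m') = 0 by
torsion-freeness of the target, and m' already lies in the kernel. -/
theorem cornerSpan_ker_eq_top (he : IsIdempotentElem e) (p : M →ₗ[Rᵐᵒᵖ] M')
    (hM : cornerSpan M e = ⊤) (hM' : D.IsTorsionFree M') :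
    cornerSpan (LinearMap.ker p) e = ⊤ := by
  rw [eq_top_iff]
  rintro n -
  refine D.mem_of_smul_mem _ (Submodule.subset_span (op_smul_mem_rightCorner he n)) fun w => ?_
  obtain ⟨m', -, h1, h2⟩ := D.exists_i_smul_eq (m := n.1) (hM ▸ Submodule.mem_top) w
  have hm' : p m' = 0 := by
    refine hM' w _ (by rw [← map_smul, h1]) ?_
    rw [← map_smul, h2]
    exact (LinearMap.ker p).smul_mem _ n.2
  have : op (D.f w) • n = op (D.i w) • (⟨m', hm'⟩ : LinearMap.ker p) := Subtype.ext h2.symm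
  rw [this]
  refine Submodule.smul_mem _ _ (Submodule.subset_span ?_)
  exact Subtype.ext (D.mem_rightCorner_of_c_smul h1)

variable {D} in
theorem IsTorsionFree.submodule (hM : D.IsTorsionFree M) (N : Submodule Rᵐᵒᵖ M) :
    D.IsTorsionFree N :=
  fun w m h1 h2 => Subtype.ext (hM w m.1 congr(($h1).1) congr(($h2).1))

theorem cornerSpan_quotient_eq_top (hM : cornerSpan M e = ⊤) (N : Submodule Rᵐᵒᵖ M) :
    cornerSpan (M ⧸ N) e = ⊤ := by
  rw [eq_top_iff, ← N.range_mkQ, LinearMap.range_eq_map, ← hM, Submodule.map_span]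
  refine Submodule.span_mono ?_
  rintro _ ⟨m, hm, rfl⟩
  change op e • N.mkQ m = N.mkQ m
  rw [← map_smul, show op e • m = m from hm]

variable (e) in
/-- The submodule generated by `Ne` for a submodule `N`. -/
abbrev _root_.Submodule.cornerSpan (N : Submodule Rᵐᵒᵖ M) : Submodule Rᵐᵒᵖ M :=
  (_root_.cornerSpan N e).map N.subtype

/-- If m c_w i_w lies in NeR, it equals m' i_w with m' in NeR and at c_w. Cancelling i_w in M gives
m c_w = m', which is zero in the quotient. -/
theorem isTorsionFree_quotient (hM : D.IsTorsionFree M) (N : Submodule Rᵐᵒᵖ M) :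
    D.IsTorsionFree (M ⧸ N.cornerSpan e) := by
  intro w x h1 h2
  obtain ⟨m, rfl⟩ := Submodule.mkQ_surjective _ x
  rw [← h1, ← map_smul, Submodule.mkQ_apply, Submodule.Quotient.mk_eq_zero]
  rw [← map_smul, Submodule.mkQ_apply, Submodule.Quotient.mk_eq_zero] at h2
  obtain ⟨n, hn, hn2⟩ := h2
  obtain ⟨m', hm', h3, h4⟩ := D.exists_i_smul_eq hn w
  have h5 : op (D.c w) • m'.1 = m'.1 := congr(($h3).1)
  have h6 : op (D.i w) • m'.1 = op (D.i w) • m := by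
    have : op (D.i w) • m'.1 = op (D.f w) • n.1 := congr(($h4).1)
    rw [this, show n.1 = op (D.i w) • m from hn2, smul_smul, ← op_mul, D.i_mul_f]
  have h7 : op (D.c w) • m - m'.1 = 0 := by
    refine hM w _ ?_ ?_
    · rw [smul_sub, h5, smul_smul, ← op_mul, D.c_mul_self]
    · rw [smul_sub, h6, smul_smul, ← op_mul, D.c_mul_i, sub_self]
  rw [sub_eq_zero.1 h7]
  exact ⟨m', hm', rfl⟩

theorem cornerSpan_cornerSpan_eq_top : cornerSpan (cornerSpan M e) e = ⊤ := by
  refine (congrArg (Submodule.span Rᵐᵒᵖ) (Set.ext fun x => ?_)).trans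
    (Submodule.span_span_coe_preimage (R := Rᵐᵒᵖ) (s := (rightCorner e M : Set M)))
  exact Subtype.ext_iff

theorem mem_cornerSpan_of_mem_rightCorner {N : Submodule Rᵐᵒᵖ M} {m : M} (hm : m ∈ N)
    (h : op e • m = m) : m ∈ N.cornerSpan e :=
  ⟨⟨m, hm⟩, Submodule.subset_span (Subtype.ext h), rfl⟩

end Modules

section Hom

variable (he : IsIdempotentElem e) {M N : Type w} [AddCommGroup M] [Module Rᵐᵒᵖ M]
  [AddCommGroup N] [Module Rᵐᵒᵖ N]

theorem smul_mem_rightCorner {s : R} (h : s * e = s) (m : M) : op s • m ∈ rightCorner e M := by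
  change op e • op s • m = op s • m
  rw [smul_smul, ← op_mul, h]

theorem coe_map_smul (φ : rightCorner e M →ₗ[he.Cornerᵐᵒᵖ] rightCorner e N) {s : R}
    (h1 : e * s = s) (h2 : s * e = s) (m : rightCorner e M) :
    (φ ⟨op s • m.1, smul_mem_rightCorner h2 _⟩ : N) = op s • (φ m).1 := by
  let b : he.Corner := ⟨s, (Subsemigroup.mem_corner_iff he).2 ⟨h1, h2⟩⟩
  exact congrArg Subtype.val (map_smul φ (op b : he.Cornerᵐᵒᵖ) m)

/-- The submodule generated by the graph of φ must be shown single-valued. For z in it, ze is a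
point (n, φ(n)), and z f_w is (n, φ(n)) multiplied by i_w with n at c_w. If the first coordinate
vanishes, torsion-freeness forces n = 0, hence the second vanishes as well. -/
theorem eq_zero_of_mem_span (hM : D.IsTorsionFree M)
    (φ : rightCorner e M →ₗ[he.Cornerᵐᵒᵖ] rightCorner e N) {y : N}
    (h : ((0 : M), y) ∈ Submodule.span Rᵐᵒᵖ (Set.range fun n => (n.1, (φ n).1))) : y = 0 := by
  have key : ∀ z ∈ Submodule.span Rᵐᵒᵖ (Set.range fun n => (n.1, (φ n).1)), ∀ r : R,
      (∃ n : rightCorner e M, n.1 = op e • op r • z.1 ∧ (φ n).1 = op e • op r • z.2) ∧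
      ∀ w, ∃ n : rightCorner e M, op (D.c w) • n.1 = n.1 ∧
        op (D.i w) • n.1 = op (D.f w) • op r • z.1 ∧
        op (D.i w) • (φ n).1 = op (D.f w) • op r • z.2 := by
    intro z hz
    induction hz using Submodule.span_induction with
    | mem z hz =>
      obtain ⟨n, rfl⟩ := hz
      have h3 : ∀ t : R, op t • n.1 = op (e * t) • n.1 := fun t => by
        rw [op_mul, mul_smul, show op e • n.1 = n.1 from n.2]
      have h4 : ∀ t : R, op t • (φ n).1 = op (e * t) • (φ n).1 := fun t => by
        rw [op_mul, mul_smul, show op e • (φ n).1 = (φ n).1 from (φ n).2]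
      refine fun r => ⟨⟨⟨op (e * (r * e)) • n.1, smul_mem_rightCorner
        (by rw [mul_assoc, mul_assoc, he.eq]) _⟩, ?_, ?_⟩, fun w => ?_⟩
      · rw [smul_smul, ← op_mul, h3 (r * e)]
      · rw [coe_map_smul he φ (by rw [← mul_assoc, he.eq]) (by rw [mul_assoc, mul_assoc, he.eq]),
          smul_smul, ← op_mul, h4 (r * e)]
      · obtain ⟨s, hs1, hs2, hs3⟩ := D.exists_mul_f w r
        have hs4 : s * e = s := by rw [← hs2, mul_assoc, D.c_mul_e]
        refine ⟨⟨op s • n.1, smul_mem_rightCorner hs4 _⟩, ?_, ?_, ?_⟩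
        · rw [smul_smul, ← op_mul, hs2]
        · rw [smul_smul, smul_smul, ← op_mul, ← op_mul, ← hs3, mul_assoc, ← h3]
        · rw [coe_map_smul he φ hs1 hs4, smul_smul, smul_smul, ← op_mul, ← op_mul, ← hs3, mul_assoc,
            ← h4]
    | zero =>
      exact fun r => ⟨⟨0, by simp, by simp⟩, fun w => ⟨0, by simp, by simp, by simp⟩⟩
    | add x y _ _ hx hy =>
      intro r
      obtain ⟨⟨n, hn1, hn2⟩, hn⟩ := hx r
      obtain ⟨⟨n', hn1', hn2'⟩, hn'⟩ := hy r
      refine ⟨⟨n + n', ?_, ?_⟩, fun w => ?_⟩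
      · simp [hn1, hn1']
      · simp [hn2, hn2']
      · obtain ⟨k, h1, h2, h3⟩ := hn w
        obtain ⟨k', h1', h2', h3'⟩ := hn' w
        exact ⟨k + k', by simp [h1, h1'], by simp [h2, h2'], by simp [h3, h3']⟩
    | smul a x _ hx =>
      intro r
      have := hx (unop a * r)
      simpa only [op_mul, op_unop, mul_smul, Prod.smul_fst, Prod.smul_snd] using this
  obtain ⟨⟨n, hn1, hn2⟩, hn⟩ := key _ h 1
  simp only [op_one, one_smul, smul_zero] at hn hn1 hn2
  rw [← D.smul_add_sum_smul y, ← hn2, show n = 0 from Subtype.ext hn1, map_zero, AddSubgroup.coe_zero,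
    zero_add]
  refine Finset.sum_eq_zero fun w _ => ?_
  obtain ⟨k, h1, h2, h3⟩ := hn w
  rw [← h3, show k = 0 from Subtype.ext (hM w _ h1 h2), map_zero, AddSubgroup.coe_zero, smul_zero]

include D in
-- Injectivity holds because Me generates M. For surjectivity, the submodule generated by the graph
-- of φ projects isomorphically onto M and is thus the graph of an extension.
theorem rightCorner_map_bijective (hM : cornerSpan M e = ⊤) (hM' : D.IsTorsionFree M) :
    Function.Bijective
      (rightCorner.map he : (M →ₗ[Rᵐᵒᵖ] N) → (rightCorner e M →ₗ[he.Cornerᵐᵒᵖ] rightCorner e N)) := by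
  constructor
  · intro f g h
    exact LinearMap.ext_on hM fun x hx => congr(($h ⟨x, hx⟩).1)
  · intro φ
    let Γ : Submodule Rᵐᵒᵖ (M × N) := Submodule.span Rᵐᵒᵖ (Set.range fun n => (n.1, (φ n).1))
    let p : Γ →ₗ[Rᵐᵒᵖ] M := LinearMap.fst Rᵐᵒᵖ M N ∘ₗ Γ.subtype
    have hΓ : ∀ n : rightCorner e M, (n.1, (φ n).1) ∈ Γ := fun n => Submodule.subset_span ⟨n, rfl⟩
    have hp : Function.Bijective p := by
      constructor
      · refine (injective_iff_map_eq_zero p).2 ?_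
        rintro ⟨⟨x, y⟩, hx⟩ (rfl : x = 0)
        exact Subtype.ext (Prod.ext rfl (D.eq_zero_of_mem_span he hM' φ hx))
      · rw [← LinearMap.range_eq_top, eq_top_iff, ← hM]
        refine Submodule.span_le.2 fun n hn => ⟨⟨_, hΓ ⟨n, hn⟩⟩, rfl⟩
    refine ⟨(LinearMap.snd Rᵐᵒᵖ M N ∘ₗ Γ.subtype) ∘ₗ (LinearEquiv.ofBijective p hp).symm, ?_⟩
    refine LinearMap.ext fun n => Subtype.ext ?_
    have : (LinearEquiv.ofBijective p hp).symm n.1 = ⟨_, hΓ n⟩ :=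
      (LinearEquiv.symm_apply_eq _).2 rfl
    exact congr(($this).1.2)

end Hom

section Cover

/-- A finite direct sum of copies of `eR`. -/
abbrev _root_.CornerFree (R : Type v) [Ring R] (e : R) (s : Type w) : Type (max v w) :=
  s → idemIdeal (op e)

variable (s : Type w)

theorem projective_cornerFree [Finite s] (he : IsIdempotentElem e) :
    Module.Projective Rᵐᵒᵖ (CornerFree R e s) := by
  have := projective_idemIdeal (s := op e) (by rw [← op_mul, he.eq])
  have := Fintype.ofFinite s
  exact Module.Projective.of_equiv
    (DFinsupp.linearEquivFunOnFintype (R := Rᵐᵒᵖ) (M := fun _ : s => idemIdeal (op e)))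

theorem cornerSpan_cornerFree [Finite s] (he : IsIdempotentElem e) :
    cornerSpan (CornerFree R e s) e = ⊤ := by
  classical
  have := Fintype.ofFinite s
  rw [eq_top_iff]
  rintro x -
  rw [← Finset.univ_sum_single x]
  refine Submodule.sum_mem _ fun k _ => ?_
  have hx : x k = (x k).1 • (⟨op e, congrArg op he.eq⟩ : idemIdeal (op e)) :=
    Subtype.ext (x k).2.symm
  rw [hx, Pi.single_smul]
  refine Submodule.smul_mem _ _ (Submodule.subset_span ?_)
  change op e • _ = _
  rw [← Pi.single_smul]
  congr 1
  exact Subtype.ext (congrArg op he.eq)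

/-- Componentwise this is the right cancellation of i_w on eRc_w. -/
theorem isTorsionFree_cornerFree : D.IsTorsionFree (CornerFree R e s) := by
  intro w x h1 h2
  funext k
  refine Subtype.ext (unop_injective ?_)
  have h1 : unop (x k).1 * D.c w = unop (x k).1 := congr(unop (($h1) k).1)
  have h2 : unop (x k).1 * D.i w = 0 := congr(unop (($h2) k).1)
  have h3 : e * unop (x k).1 = unop (x k).1 := congrArg unop (x k).2
  have := D.mul_c_eq_zero h2
  rwa [h3, h1] at this

/-- The elements of `eR` fixed by `e` form `eRe`. -/
def cornerFreeToCorner (he : IsIdempotentElem e) :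
    rightCorner e (CornerFree R e s) →ₗ[he.Cornerᵐᵒᵖ] (s → he.Cornerᵐᵒᵖ) where
  toFun := fun x k => @op he.Corner ⟨unop (x.1 k).1, (Subsemigroup.mem_corner_iff he).2
    ⟨congrArg unop (x.1 k).2, congr(unop ($(x.2) k).1)⟩⟩
  map_add' := fun _ _ => rfl
  map_smul' := fun _ _ => rfl

theorem projective_rightCorner_cornerFree [Finite s] (he : IsIdempotentElem e) :
    Module.Projective he.Cornerᵐᵒᵖ (rightCorner e (CornerFree R e s)) := by
  let f : (s → he.Cornerᵐᵒᵖ) →ₗ[he.Cornerᵐᵒᵖ] rightCorner e (CornerFree R e s) :=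
    { toFun := fun y => ⟨fun k => ⟨op (unop (y k)).1,
        congrArg op (IsIdempotentElem.Corner.idem_mul he (unop (y k)))⟩, funext fun k => Subtype.ext
          (congrArg op (IsIdempotentElem.Corner.mul_idem he (unop (y k))))⟩
      map_add' := fun _ _ => rfl
      map_smul' := fun _ _ => rfl }
  exact Module.Projective.of_split (cornerFreeToCorner s he) f rfl

/-- Finitely many generators can be taken inside Me, and an element fixed by e is the image of e
under a homomorphism from eR. -/
theorem exists_cornerFree_surjective (he : IsIdempotentElem e) {M : Type w} [AddCommGroup M] [Module Rᵐᵒᵖ M]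
    [Module.Finite Rᵐᵒᵖ M] (hM : cornerSpan M e = ⊤) :
    ∃ (n : ℕ) (p : CornerFree R e (Fin n) →ₗ[Rᵐᵒᵖ] M), Function.Surjective p := by
  have hfg : (cornerSpan M e).FG := hM ▸ Module.Finite.fg_top
  obtain ⟨s, hs, hs'⟩ := (Submodule.fg_span_iff_fg_span_finset_subset _).1 hfg
  let x : Fin s.card → M := fun k => (s.equivFin.symm k).1
  have hx : ∀ k, op e • x k = x k := fun k => hs (s.equivFin.symm k).2
  refine ⟨s.card, ∑ k, LinearMap.toSpanSingleton Rᵐᵒᵖ M (x k) ∘ₗ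
    (idemIdeal (op e)).subtype ∘ₗ LinearMap.proj k, ?_⟩
  rw [← LinearMap.range_eq_top, eq_top_iff, ← hM, cornerSpan, hs']
  refine Submodule.span_le.2 fun m hm => ?_
  refine ⟨Pi.single (s.equivFin ⟨m, hm⟩) ⟨op e, congrArg op he.eq⟩, ?_⟩
  rw [LinearMap.sum_apply, Finset.sum_eq_single (s.equivFin ⟨m, hm⟩)]
  · change (Pi.single (M := fun _ => idemIdeal (op e)) (s.equivFin ⟨m, hm⟩)
      (⟨op e, congrArg op he.eq⟩ : idemIdeal (op e)) (s.equivFin ⟨m, hm⟩)).1 • x _ = m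
    rw [Pi.single_eq_same, hx]
    simp [x]
  · intro k _ hk
    change (Pi.single (M := fun _ => idemIdeal (op e)) (s.equivFin ⟨m, hm⟩)
      (⟨op e, congrArg op he.eq⟩ : idemIdeal (op e)) k).1 • x k = 0
    rw [Pi.single_eq_of_ne hk]
    exact zero_smul _ _
  · exact fun h => absurd (Finset.mem_univ _) h

end Cover

end SegmentData

section

variable {K : Type u} [Field K] {R : Type v} [Ring R] [Algebra K R] {e : R}
  (he : IsIdempotentElem e)

theorem isZero_resFunctor_obj {M : FinDimMod K R} (hM : ∀ m : M.obj, op e • m = 0) :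
    Limits.IsZero ((resFunctor he K).obj M) := by
  have : Subsingleton ((resFunctor he K).obj M).obj :=
    ⟨fun x y => Subtype.ext (((show op e • x.1 = x.1 from x.2).symm.trans (hM x.1)).trans
      ((show op e • y.1 = y.1 from y.2).symm.trans (hM y.1)).symm)⟩
  exact isFinDim.isZero _

end

/-! ### The homological isomorphism -/

namespace SegmentData

variable {K : Type u} [Field K] {R : Type v} [Ring R] [Algebra K R] {e : R}
  {ι : Type*} [Fintype ι] (D : SegmentData K e ι) (he : IsIdempotentElem e)

/-- The modules on which `M ↦ Me` is fully faithful: those that are generated by `Me` and on which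
the paths into the added vertices act injectively. -/
def isReflected : ObjectProperty (FinDimMod K R) :=
  fun M => cornerSpan M.obj e = ⊤ ∧ D.IsTorsionFree M.obj

theorem resFunctor_map_bijective (M : FinDimMod K R) (hM : D.isReflected M) (N : FinDimMod K R) :
    Function.Bijective ((resFunctor he K).map : (M ⟶ N) → _) := by
  have h := D.rightCorner_map_bijective he (N := N.obj) hM.1 hM.2
  constructor
  · intro f g hfg
    have := h.1 (congr(($hfg).hom.hom) : rightCorner.map he f.hom.hom = rightCorner.map he g.hom.hom)
    ext x
    exact congr($this x)
  · intro φ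
    obtain ⟨f, hf⟩ := h.2 φ.hom.hom
    refine ⟨ObjectProperty.homMk (ModuleCat.ofHom f), ?_⟩
    ext x
    exact congr($hf x)

variable [FiniteDimensional K R]

theorem isFinDim_cornerFree (n : ℕ) :
    isFinDim K Rᵐᵒᵖ (ModuleCat.of _ (CornerFree R e (Fin n))) := by
  have : IsNoetherian K Rᵐᵒᵖ := inferInstance
  have : IsNoetherian Rᵐᵒᵖ Rᵐᵒᵖ := isNoetherian_of_tower K inferInstance
  exact isFinDim_of_finite _

open scoped ModuleCat in
theorem exists_cover (M : FinDimMod K R) (hM : cornerSpan M.obj e = ⊤) :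
    ∃ (P : FinDimMod K R) (p : P.obj →ₗ[Rᵐᵒᵖ] M.obj), Function.Surjective p ∧ D.isReflected P ∧
      Projective P ∧ Projective ((resFunctor he K).obj P) := by
  have : FiniteDimensional K M.obj := M.property
  have : Module.Finite Rᵐᵒᵖ M.obj := Module.Finite.of_restrictScalars_finite K _ _
  obtain ⟨n, p, hp⟩ := exists_cornerFree_surjective he hM
  exact ⟨isFinDim.of K _ (isFinDim_cornerFree n), p, hp,
    ⟨cornerSpan_cornerFree _ he, D.isTorsionFree_cornerFree _⟩,
    isFinDim.projective (projective_cornerFree _ he),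
    isFinDim.projective (projective_rightCorner_cornerFree _ he)⟩

include he in
-- The class is resolving: a cover by copies of eR has its kernel in the class, by
-- `cornerSpan_ker_eq_top` and stability of torsion-freeness under submodules.
theorem mapExt_bijective_of_isReflected [HasExt.{w} (FinDimMod K R)]
    [HasExt.{w} (FinDimMod K he.Corner)] (M N : FinDimMod K R) (hM : D.isReflected M) (j : ℕ) :
    Function.Bijective ((resFunctor he K).mapExtAddHom M N j) := by
  refine mapExt_bijective_of_resolving _ D.isReflected (D.resFunctor_map_bijective he) ?_ M N hM j
  intro M hM
  obtain ⟨P, p, hp, hP, hP1, hP2⟩ := D.exists_cover he M hM.1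
  exact ⟨_, P, _, _, _, kerComplex_shortExact p hp,
    ⟨D.cornerSpan_ker_eq_top he p hP.1 hM.2, hP.2.submodule _⟩, hP, hP1, hP2⟩

include he in
/-- Every module generated by `Me` is the quotient of a module in `isReflected` by a submodule
annihilated by `e`. -/
theorem exists_isReflected_surjective (M : FinDimMod K R) (hM : cornerSpan M.obj e = ⊤) :
    ∃ (G : FinDimMod K R) (q : G.obj →ₗ[Rᵐᵒᵖ] M.obj), D.isReflected G ∧ Function.Surjective q ∧
      ∀ x, q x = 0 → op e • x = 0 := by
  obtain ⟨P, p, hp, hP, -, -⟩ := D.exists_cover he M hM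
  -- Dividing only by the part of ker p generated by (ker p)e keeps the quotient torsion-free, while
  -- what remains of the kernel is annihilated by e.
  let N := (LinearMap.ker p).cornerSpan e
  have hN : N ≤ LinearMap.ker p := Submodule.map_subtype_le _ _
  refine ⟨isFinDim.of K (P.obj ⧸ N) (isFinDim_quotient P.property N), N.liftQ p hN,
    ⟨cornerSpan_quotient_eq_top hP.1 _, D.isTorsionFree_quotient hP.2 _⟩, ?_, ?_⟩
  · exact fun y => (hp y).imp' N.mkQ fun x hx => hx
  · intro x hx
    obtain ⟨x, rfl⟩ := N.mkQ_surjective x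
    refine (N.mkQ.map_smul (op e) x).symm.trans ((Submodule.Quotient.mk_eq_zero N).2 ?_)
    refine mem_cornerSpan_of_mem_rightCorner ?_ (op_smul_mem_rightCorner he x)
    exact (LinearMap.ker p).smul_mem _ hx

open Abelian

section

variable [HasExt.{w} (FinDimMod K R)] [HasExt.{w} (FinDimMod K he.Corner)]

include D

/-- Pass from X to XeR, then to a reflected module G over XeR. Both steps alter X only by modules
annihilated by e, which have projective dimension at most one over R and become zero under (-)e. On
G the functor itself compares Ext. -/
theorem ext_iso (X Y : FinDimMod K R) {j : ℕ} (hj : 2 < j) :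
    Nonempty (Ext X Y j ≃+ Ext ((resFunctor he K).obj X) ((resFunctor he K).obj Y) j) := by
  let F := resFunctor he K
  let S := submoduleComplex X (cornerSpan X.obj e)
  have hS : S.ShortExact := submoduleComplex_shortExact _ _
  have h3 : ∀ x : S.X₃.obj, op e • x = 0 := by
    intro x
    obtain ⟨x, rfl⟩ := (cornerSpan X.obj e).mkQ_surjective x
    exact ((cornerSpan X.obj e).mkQ.map_smul (op e) x).symm.trans
      ((Submodule.Quotient.mk_eq_zero _).2 (Submodule.subset_span (op_smul_mem_rightCorner he x)))
  have := D.hasProjectiveDimensionLT_of_annihilated S.X₃ h3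
  obtain ⟨G, q, hG, hq, hq'⟩ := D.exists_isReflected_surjective he S.X₁ cornerSpan_cornerSpan_eq_top
  let T := kerComplex q
  have hT : T.ShortExact := kerComplex_shortExact q hq
  have h1 : ∀ x : T.X₁.obj, op e • x = 0 := fun x => Subtype.ext (hq' x.1 x.2)
  have := D.hasProjectiveDimensionLT_of_annihilated T.X₁ h1
  have : IsIso (F.map S.f) :=
    (resFunctor_map_shortExact he hS).isIso_f_iff.2 (isZero_resFunctor_obj he h3)
  have : IsIso (F.map T.g) :=
    (resFunctor_map_shortExact he hT).isIso_g_iff.2 (isZero_resFunctor_obj he h1)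
  let E1 := AddEquiv.ofBijective _
    (precomp_bijective_of_hasProjectiveDimensionLT_X₃ hS Y (j := j) hj.le)
  let E2 := AddEquiv.ofBijective _
    (precomp_bijective_of_hasProjectiveDimensionLT_X₁ hT Y (j := j) hj)
  let E3 := AddEquiv.ofBijective _ (D.mapExt_bijective_of_isReflected he G Y hG j)
  let E4 := AddEquiv.ofBijective _ (precomp_bijective_of_isIso (F.obj Y) (F.map T.g) j)
  let E5 := AddEquiv.ofBijective _ (precomp_bijective_of_isIso (F.obj Y) (F.map S.f) j)
  exact ⟨(((E1.trans E2).trans E3).trans E4.symm).trans E5.symm⟩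

end

include D

theorem isHomologicalIso : IsHomologicalIso (resFunctor he K) 2 := by
  intro X Y j hj
  let := HasExt.standard (FinDimMod K R)
  let := HasExt.standard (FinDimMod K he.Corner)
  exact D.ext_iso he X Y (by exact_mod_cast hj)

end SegmentData

/-! ### Injective dimensions -/

section Equivalence

open Limits Abelian

universe v₁ v₂ u₁ u₂

variable {C : Type u₁} [Category.{v₁} C] [Abelian C] {D : Type u₂} [Category.{v₂} D] [Abelian D]

/-- An equivalence preserves projectives, so it is bijective on Ext and vanishing can be tested in
the target. -/
theorem hasInjectiveDimensionLT_of_isEquivalence [EnoughProjectives C] (F : C ⥤ D)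
    [F.IsEquivalence] [F.Additive] (X : C) (n : ℕ) [HasInjectiveDimensionLT (F.obj X) n] :
    HasInjectiveDimensionLT X n := by
  let := HasExt.standard C
  let := HasExt.standard D
  have : F.PreservesProjectiveObjects :=
    F.preservesProjectiveObjects_of_adjunction_of_preservesEpimorphisms F.asEquivalence.toAdjunction
  refine HasInjectiveDimensionLT.mk fun i hi Y x => ?_
  refine (F.mapExt_bijective_of_preservesProjectiveObjects Y X i).1 ?_
  rw [map_zero]
  exact Ext.eq_zero_of_hasInjectiveDimensionLT _ n hi

end Equivalence

section FinDim

variable (K : Type u) [Field K] (R : Type v) [Ring R] [Algebra K R] [FiniteDimensional K R]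

open scoped ModuleCat in
instance : EnoughProjectives (FinDimMod K R) where
  presentation M := by
    have : FiniteDimensional K M.obj := M.property
    have : Module.Finite Rᵐᵒᵖ M.obj := Module.Finite.of_restrictScalars_finite K _ _
    have hM : cornerSpan M.obj (1 : R) = ⊤ :=
      eq_top_iff.2 fun m _ => Submodule.subset_span (one_smul Rᵐᵒᵖ m)
    obtain ⟨n, p, hp⟩ := SegmentData.exists_cornerFree_surjective .one hM
    exact ⟨{
      p := isFinDim.of K _ (SegmentData.isFinDim_cornerFree (e := 1) n)
      projective := isFinDim.projective (SegmentData.projective_cornerFree _ .one)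
      f := ObjectProperty.homMk (ModuleCat.ofHom p)
      epi := (isFinDim.epi_iff _).2 hp }⟩

end FinDim

section RestrictScalars

variable {K : Type u} [Field K] {R S : Type v} [Ring R] [Ring S] [Algebra K R] [Algebra K S]
  (φ : R ≃ₐ[K] S)

/-- The equivalence between the categories of finite-dimensional modules over isomorphic algebras. -/
noncomputable def finDimEquivalence : FinDimMod K S ≌ FinDimMod K R :=
  (ModuleCat.restrictScalarsEquivalenceOfRingEquiv
    (RingEquiv.op φ.toRingEquiv)).congrFullSubcategory (by
      ext M
      let N := (ModuleCat.restrictScalars (RingEquiv.op φ.toRingEquiv).toRingHom).obj M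
      have h : @Eq (Module K M) (Module.restrictScalars K Rᵐᵒᵖ N)
          (Module.restrictScalars K Sᵐᵒᵖ M) := by
        refine Module.ext' _ _ fun k m => ?_
        change op (φ (algebraMap K R k)) • m = op (algebraMap K S k) • m
        rw [φ.commutes]
      change @Module.Finite K M _ _ (Module.restrictScalars K Rᵐᵒᵖ N) ↔
        @Module.Finite K M _ _ (Module.restrictScalars K Sᵐᵒᵖ M)
      exact iff_of_eq (congrArg (@Module.Finite K M _ _) h))

instance : (finDimEquivalence φ).functor.Additive where
  map_add := rfl

variable [FiniteDimensional K R] [FiniteDimensional K S]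

/-- The equivalence `finDimEquivalence` preserves the regular module. -/
noncomputable def finDimEquivalenceRegularIso :
    (finDimEquivalence φ).functor.obj (FinDimMod.regular K S) ≅ FinDimMod.regular K R :=
  let e : (ModuleCat.restrictScalars (RingEquiv.op φ.toRingEquiv).toRingHom).obj
      (ModuleCat.of Sᵐᵒᵖ S) ≃ₗ[Rᵐᵒᵖ] R :=
    { toFun := fun x : S => φ.symm x
      invFun := fun x : R => φ x
      left_inv := φ.apply_symm_apply
      right_inv := φ.symm_apply_apply
      map_add' := map_add φ.symm
      map_smul' := fun r (x : S) => by
        change φ.symm (x * φ (unop r)) = φ.symm x * unop r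
        rw [map_mul, φ.symm_apply_apply] }
  (isFinDim K Rᵐᵒᵖ).isoMk e.toModuleIso

include φ

theorem hasInjectiveDimensionLT_regular_of_algEquiv (n : ℕ)
    [HasInjectiveDimensionLT (FinDimMod.regular K R) n] :
    HasInjectiveDimensionLT (FinDimMod.regular K S) n := by
  have := hasInjectiveDimensionLT_of_iso (finDimEquivalenceRegularIso φ).symm n
  exact hasInjectiveDimensionLT_of_isEquivalence (finDimEquivalence φ).functor _ n

end RestrictScalars

namespace SegmentData

variable {K : Type u} [Field K] {R : Type v} [Ring R] [Algebra K R] {e : R}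
  {ι : Type*} [Fintype ι] (D : SegmentData K e ι) (he : IsIdempotentElem e)
  [FiniteDimensional K R] [FiniteDimensional K he.Corner]

open Abelian

include D

/-- The dual basis writes the identity of Re as a finite sum of endomorphisms through eRe. Hence
every Ext class into Re is a sum of classes factoring through Ext into eRe, which vanish. -/
theorem hasInjectiveDimensionLT_resFunctor_regular (n : ℕ)
    [HasInjectiveDimensionLT (FinDimMod.regular K he.Corner) n] :
    HasInjectiveDimensionLT ((resFunctor he K).obj (FinDimMod.regular K R)) n := by
  obtain ⟨x, φ, h⟩ := D.exists_dualBasis he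
  let F := (resFunctor he K).obj (FinDimMod.regular K R)
  let U : he.Cornerᵐᵒᵖ →ₗ[he.Cornerᵐᵒᵖ] he.Corner :=
    { toFun := unop
      map_add' := fun _ _ => rfl
      map_smul' := fun _ _ => rfl }
  let V : he.Corner →ₗ[he.Cornerᵐᵒᵖ] he.Cornerᵐᵒᵖ :=
    { toFun := op
      map_add' := fun _ _ => rfl
      map_smul' := fun _ _ => rfl }
  let p (k : Option ι) : F ⟶ FinDimMod.regular K he.Corner :=
    ObjectProperty.homMk (ModuleCat.ofHom (U ∘ₗ φ k))
  let q (k : Option ι) : FinDimMod.regular K he.Corner ⟶ F :=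
    ObjectProperty.homMk (ModuleCat.ofHom (LinearMap.toSpanSingleton he.Cornerᵐᵒᵖ _ (x k) ∘ₗ V))
  have hpq : ∑ k, p k ≫ q k = 𝟙 F := by
    ext m
    have h1 : (∑ k, p k ≫ q k).hom = ∑ k, (p k ≫ q k).hom := (isFinDim K _).ι.map_sum _ _
    rw [h1, ModuleCat.hom_sum, LinearMap.sum_apply]
    exact h m
  let := HasExt.standard (FinDimMod K he.Corner)
  refine HasInjectiveDimensionLT.mk fun i hi Y z => ?_
  rw [← z.comp_mk₀_id, ← hpq, Ext.mk₀_sum, Ext.comp_sum]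
  refine Finset.sum_eq_zero fun k _ => ?_
  rw [← Ext.mk₀_comp_mk₀, ← Ext.comp_assoc_of_second_deg_zero,
    (z.comp (Ext.mk₀ (p k)) (add_zero i)).eq_zero_of_hasInjectiveDimensionLT n hi, Ext.zero_comp]

/-- All degrees i ≥ n exceed 2, so Ext into R is Ext into Re over eRe. A merely abstract isomorphism
suffices for vanishing. -/
theorem hasInjectiveDimensionLT_regular (n : ℕ) (hn : 2 < n)
    [HasInjectiveDimensionLT (FinDimMod.regular K he.Corner) n] :
    HasInjectiveDimensionLT (FinDimMod.regular K R) n := by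
  have := D.hasInjectiveDimensionLT_resFunctor_regular he n
  let := HasExt.standard (FinDimMod K R)
  let := HasExt.standard (FinDimMod K he.Corner)
  refine HasInjectiveDimensionLT.mk fun i hi Y z => ?_
  obtain ⟨E⟩ := D.ext_iso he Y (FinDimMod.regular K R) (hn.trans_le hi)
  refine E.injective ?_
  rw [map_zero]
  exact Ext.eq_zero_of_hasInjectiveDimensionLT _ n hi

end SegmentData

theorem injectiveDimension_le_max {C D : Type*} [Category* C] [Abelian C] [Category* D] [Abelian D]
    {X : C} {Y : D} {m : ℕ}
    (h : ∀ n : ℕ, m < n → HasInjectiveDimensionLT X n → HasInjectiveDimensionLT Y n) :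
    injectiveDimension Y ≤ max (injectiveDimension X) m := by
  have key : ∀ n : ℕ, injectiveDimension X ≤ n → injectiveDimension Y ≤ (max n m : ℕ) := by
    intro n hn
    rw [injectiveDimension_le_iff] at hn ⊢
    -- Dimension at most d means vanishing from degree d + 1 on, and max n m + 1 exceeds m as
    -- required.
    exact h _ (by omega) (hasInjectiveDimensionLT_of_ge X (n + 1) _ (by omega))
  have hmax (n : ℕ) : ((max n m : ℕ) : WithBot ℕ∞) = max (n : WithBot ℕ∞) m :=
    (Nat.mono_cast (α := WithBot ℕ∞)).map_max
  generalize injectiveDimension X = d at key ⊢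
  induction d with
  -- For dimension -∞ the bound n = 0 already gives m.
  | bot => simpa using key 0 bot_le
  | coe d =>
    induction d with
    | top => exact le_max_of_le_left le_top
    | coe d => exact (key d le_rfl).trans (hmax d).le

theorem mainTheorem4 {K : Type u} [Field K] [IsAlgClosed K]
    {V : Type v} [Quiver.{w} V] [Fintype V] [∀ a b : V, Finite (a ⟶ b)]
    (g : Set (PathAlgebra K V)) (hg : ∀ x ∈ g, PathAlgebra.IsUniform x)
    [FiniteDimensional K (PathAlgebra.Quot g)] (A : ℕ) [NeZero A] :
    ∃ _ : FiniteDimensional K (StretchedAlgebra A g),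
      IsStratifyingIdeal (stretchedIdempotent_isIdempotentElem A g) ∧
      IsHomologicalIso (resFunctor (stretchedIdempotent_isIdempotentElem A g) K) 2 ∧
      IsEventuallyHomologicalIso (resFunctor (stretchedIdempotent_isIdempotentElem A g) K) ∧
      injectiveDimension (FinDimMod.regular K (StretchedAlgebra A g)) ≤
        max (injectiveDimension (FinDimMod.regular K (PathAlgebra.Quot g))) 2 := by
  let he := stretchedIdempotent_isIdempotentElem A g
  let D := StretchedAlgebra.segmentData A g
  have hC : FiniteDimensional K he.Corner :=
    Module.Finite.equiv (StretchedAlgebra.cornerEquiv A g).toLinearEquiv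
  have hR : FiniteDimensional K (StretchedAlgebra A g) := D.finiteDimensional he
  refine ⟨hR, D.isStratifyingIdeal he, D.isHomologicalIso he, ⟨2, D.isHomologicalIso he⟩,
    injectiveDimension_le_max fun n hn _ => ?_⟩
  have := hasInjectiveDimensionLT_regular_of_algEquiv (StretchedAlgebra.cornerEquiv A g) n
  exact D.hasInjectiveDimensionLT_regular he n hn
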